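/- **Setting.** An instance of the generalized assignment problem (GAP) consists of a finite set $E$ of items, $m\ge 1$ knapsacks with capacities $C_j>0$, and values $v_{ij}\ge 0$ and weights $w_{ij}\ge 0$ for $i\in E$, $j\in[m]$. A valid assignment is a set $\mathbf S\subseteq E\times[m]$ in which each item occurs at most once and $\sum_{(i,j)\in\mathbf S}w_{ij}\le C_j$ for every $j$; its value is $\sum_{(i,j)\in\mathbf S}v_{ij}$. Let $\mathcal F\subseteq 2^E$ be the family of the item sets of valid assignments, let $\mathcal P_{\mathcal F}=\operatorname{conv}\{\mathbf 1_S: S\in\mathcal F\}$, let $f(S)$ be the maximum value of a valid assignment of items in $S$, and for $X\subseteq E$ put $\mathrm{OPT}(X)=\max\{f(S): S\in\mathcal F,\ S\subseteq X\}$. The active set $R\subseteq E$ contains each item independently with probability $p\in(0,1]$, and $\mathbb E_R[\mathrm{OPT}]=\mathbb E_R[\mathrm{OPT}(R)]$. An algorithm is an $\alpha$-sparsifier with degree $d\geq 1$ if, for every instance, its output $Q\subseteq E$ satisfies $\frac1d\mathbf 1_Q\in\mathcal P_{\mathcal F}$ and $\mathbb E_R[\mathrm{OPT}(Q\cap R)]\ge\alpha\,\mathbb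 E_R[\mathrm{OPT}(R)]$. **Algorithm.** Let $\epsilon\in(0,1/6)$. Given $\mathbb E_R[\mathrm{OPT}]$, put $M_j=\mathbb E_R[\mathrm{OPT}]/m$ for all $j$, $K=\left\lceil\frac{2}{\epsilon^2}\log\frac{m}{\epsilon^3}\right\rceil$ (natural logarithm), and $\tau(x)=1+\ln\frac1x+\sqrt{\ln^2\frac1x+2\ln\frac1x}$. A pair $(i,j)$ belongs to bucket $k=0$ of $j$ if $v_{ij}\le\epsilon^2M_j$; to bucket $k$, $1\le k\le K$, if $\epsilon^2(1+\epsilon^2)^{k-1}M_j<v_{ij}\le\epsilon^2(1+\epsilon^2)^kM_j$; and to bucket $K+1$ if $v_{ij}>\epsilon^2(1+\epsilon^2)^KM_j$. Start with $Q=\emptyset$ and perform $\lceil 1/\epsilon\rceil-1$ rounds. Each round first resets $b(j,k)=\frac{\tau(\epsilon^2)}{p}C_j$ for all $j$ and all $0\le k\le K+1$. Call a pair $(i,j)$ in bucket $k$ of $j$ *available* if $i\notin Q$, $w_{ij}\le C_j$ and $b(j,k)>0$. While there is an available pair in a bucket of index $k\geq1$, the round selects one with minimal $w_{ij}$ among all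 of these, adds $i$ to $Q$ and decreases $b(j,k)$ by $w_{ij}$. Then, while there is an available pair in a bucket of index $0$, it selects one with maximal $v_{ij}/w_{ij}$ among all of these (where $v/0=\infty$ for $v>0$ and $0/0=0$), adds $i$ to $Q$ and decreases $b(j,0)$ by $w_{ij}$. The output is the final $Q$; ties are broken arbitrarily. **Corollary.** There is an absolute constant $c>0$ such that, for all $\epsilon\in(0,1/6)$, $p\in(0,1]$, $m\ge1$ and every GAP instance with $m$ knapsacks, the algorithm has an output, and every possible output $Q$ (however ties are broken) satisfies the two conditions of a $(1-6\epsilon)$-sparsifier with degree $$d=c\cdot\frac{\log^2(1/\epsilon)\,\log(\max\{m,2\})}{\epsilon^3p}.$$ -/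

import Mathlib

/-! Packing problems, polyhedral degree, sparsifiers -/

/-- A packing problem on the finite ground set `E`: a nonempty downward-closed family of feasible
sets together with a nonnegative objective. -/
structure PackingProblem (E : Type*) where
  feasible : Set (Finset E)
  empty_feasible : ∅ ∈ feasible
  down_closed : ∀ S ∈ feasible, ∀ T ⊆ S, T ∈ feasible
  objective : Finset E → ℝ
  objective_nonneg : ∀ S, 0 ≤ objective S

namespace PackingProblem

variable {E : Type*}

open Classical in
/-- The feasible sets contained in `X`. -/
noncomputable def feasibleIn (P : PackingProblem E) (X : Finset E) : Finset (Finset E) :=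
  X.powerset.filter (fun S => S ∈ P.feasible)

theorem feasibleIn_nonempty (P : PackingProblem E) (X : Finset E) : (P.feasibleIn X).Nonempty :=
  ⟨∅, by simp [feasibleIn, P.empty_feasible]⟩

/-- `max { f(S) : S feasible, S ⊆ X }`. -/
noncomputable def opt (P : PackingProblem E) (X : Finset E) : ℝ :=
  (P.feasibleIn X).sup' (P.feasibleIn_nonempty X) P.objective

/-- The 0/1 indicator vector of a set of elements. -/
def indicatorVec [DecidableEq E] (S : Finset E) : E → ℝ := fun i => if i ∈ S then 1 else 0

/-- The convex hull of the indicator vectors of the feasible sets. -/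
def polytope [DecidableEq E] (P : PackingProblem E) : Set (E → ℝ) :=
  convexHull ℝ (indicatorVec '' P.feasible)

/-- The expectation of `g R`, where `R` contains each element independently with probability
`p`. -/
noncomputable def expect [Fintype E] [DecidableEq E] (p : ℝ) (g : Finset E → ℝ) : ℝ :=
  ∑ R : Finset E, (∏ i : E, if i ∈ R then p else 1 - p) * g R

/-- The expected optimum over the random active set. -/
noncomputable def expectedOpt [Fintype E] [DecidableEq E] (P : PackingProblem E) (p : ℝ) : ℝ :=
  expect p (fun R => P.opt R)

/-- The query set `Q` meets the two requirements on the output of an `α`-approximate sparsifier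
with degree `d` on the problem `P` with activation probability `p`. -/
def IsSparsifying [Fintype E] [DecidableEq E] (P : PackingProblem E) (p α d : ℝ)
    (Q : Finset E) : Prop :=
  (1 ≤ d ∧ (1 / d) • indicatorVec Q ∈ P.polytope) ∧
    α * P.expectedOpt p ≤ expect p (fun R => P.opt (Q ∩ R))

end PackingProblem

/-! The generalized assignment problem -/

/-- An instance of the generalized assignment problem with items `E` and `m` knapsacks. -/
structure GAP (E : Type*) (m : ℕ) where
  value : E → Fin m → ℝ
  weight : E → Fin m → ℝ
  cap : Fin m → ℝ
  value_nonneg : ∀ i j, 0 ≤ value i j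
  weight_nonneg : ∀ i j, 0 ≤ weight i j
  cap_pos : ∀ j, 0 < cap j

namespace GAP

variable {E : Type*} {m : ℕ}

/-- Each item occurs in at most one pair of the assignment, and no knapsack is overfull. -/
def IsValid (I : GAP E m) (A : Finset (E × Fin m)) : Prop :=
  (∀ x ∈ A, ∀ y ∈ A, x.1 = y.1 → x = y) ∧
    ∀ j, ∑ x ∈ A with x.2 = j, I.weight x.1 j ≤ I.cap j

/-- The total value of an assignment. -/
def totalValue (I : GAP E m) (A : Finset (E × Fin m)) : ℝ :=
  ∑ x ∈ A, I.value x.1 x.2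

/-- The set of items that an assignment uses. -/
def items [DecidableEq E] (A : Finset (E × Fin m)) : Finset E := A.image Prod.fst

theorem isValid_mono (I : GAP E m) {A B : Finset (E × Fin m)} (hA : I.IsValid A) (h : B ⊆ A) :
    I.IsValid B :=
  ⟨fun x hx y hy hxy => hA.1 x (h hx) y (h hy) hxy, fun j =>
    (Finset.sum_le_sum_of_subset_of_nonneg (Finset.filter_subset_filter _ h)
      (fun x _ _ => I.weight_nonneg x.1 j)).trans (hA.2 j)⟩

theorem isValid_empty (I : GAP E m) : I.IsValid ∅ :=
  ⟨by simp, fun j => by simpa using (I.cap_pos j).le⟩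

open Classical in
/-- The valid assignments of items in `S`. -/
noncomputable def assignmentsIn [Fintype E] [DecidableEq E] (I : GAP E m) (S : Finset E) :
    Finset (Finset (E × Fin m)) :=
  Finset.univ.filter (fun A => I.IsValid A ∧ items A ⊆ S)

theorem assignmentsIn_nonempty [Fintype E] [DecidableEq E] (I : GAP E m) (S : Finset E) :
    (I.assignmentsIn S).Nonempty :=
  ⟨∅, by
    classical
    exact Finset.mem_filter.2 ⟨Finset.mem_univ _, I.isValid_empty, by simp [items]⟩⟩

/-- The maximum value of a valid assignment of items in `S`. -/
noncomputable def bestValue [Fintype E] [DecidableEq E] (I : GAP E m) (S : Finset E) : ℝ :=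
  (I.assignmentsIn S).sup' (I.assignmentsIn_nonempty S) I.totalValue

/-- The generalized assignment problem as a packing problem on the set of items: a set is feasible
if it is exactly the set of items of some valid assignment. -/
noncomputable def toPacking [Fintype E] [DecidableEq E] (I : GAP E m) : PackingProblem E where
  feasible := {S | ∃ A, I.IsValid A ∧ items A = S}
  empty_feasible := ⟨∅, I.isValid_empty, by simp [items]⟩
  down_closed := by
    rintro S ⟨A, hA, rfl⟩ T hT
    refine ⟨A.filter (fun x => x.1 ∈ T), I.isValid_mono hA (Finset.filter_subset _ _), ?_⟩
    ext i
    simp only [items, Finset.mem_image, Finset.mem_filter]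
    constructor
    · rintro ⟨x, ⟨_, h⟩, rfl⟩
      exact h
    · intro hi
      obtain ⟨x, hx, rfl⟩ := Finset.mem_image.1 (hT hi)
      exact ⟨x, ⟨hx, hi⟩, rfl⟩
  objective := I.bestValue
  objective_nonneg := fun S =>
    Finset.le_sup'_of_le _ (b := ∅)
      (by
        classical
        exact Finset.mem_filter.2 ⟨Finset.mem_univ _, I.isValid_empty, by simp [items]⟩)
      (by simp [totalValue])

/-! The bucket-based sparsifier -/

/-- The concentration factor `τ`. -/
noncomputable def tau (x : ℝ) : ℝ :=
  1 + Real.log (1 / x) + Real.sqrt (Real.log (1 / x) ^ 2 + 2 * Real.log (1 / x))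

/-- The pair `(i, j)` lies in the bucket `B_{j,k}`, for the scales `M` and `K` regular buckets
besides the bucket `0` of low values and the unbounded super bucket `K + 1`. -/
def InBucket (I : GAP E m) (ε : ℝ) (K : ℕ) (M : Fin m → ℝ) (i : E) (j : Fin m) (k : ℕ) : Prop :=
  (k = 0 ∧ I.value i j ≤ ε ^ 2 * M j) ∨
  (1 ≤ k ∧ k ≤ K ∧ ε ^ 2 * (1 + ε ^ 2) ^ (k - 1) * M j < I.value i j ∧
    I.value i j ≤ ε ^ 2 * (1 + ε ^ 2) ^ k * M j) ∨
  (k = K + 1 ∧ ε ^ 2 * (1 + ε ^ 2) ^ K * M j < I.value i j)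

/-- The ratio `v_{ij} / w_{ij}`, which is `∞` if only the weight is zero (and `0` if both are). -/
noncomputable def density (I : GAP E m) (i : E) (j : Fin m) : ENNReal :=
  ENNReal.ofReal (I.value i j) / ENNReal.ofReal (I.weight i j)

/-- The program state: the query set and the remaining capacities `b(j, k)`. -/
structure State (E : Type*) (m : ℕ) where
  queried : Finset E
  rem : Fin m → ℕ → ℝ

/-- Query item `i` through the bucket `(j, k)`. -/
noncomputable def State.query [DecidableEq E] (I : GAP E m) (s : State E m)
    (i : E) (j : Fin m) (k : ℕ) : State E m where
  queried := insert i s.queried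
  rem := fun j' k' => if j' = j ∧ k' = k then s.rem j k - I.weight i j else s.rem j' k'

/-- Querying `(i, j)`, a pair of bucket `k`, is allowed in the state `s`. -/
def IsCandidate [DecidableEq E] (I : GAP E m) (ε : ℝ) (K : ℕ) (M : Fin m → ℝ) (s : State E m)
    (i : E) (j : Fin m) (k : ℕ) : Prop :=
  i ∉ s.queried ∧ I.InBucket ε K M i j k ∧ I.weight i j ≤ I.cap j ∧ 0 < s.rem j k

/-- The body of the first loop: query an allowed pair of minimal weight, among all pairs in
buckets of index at least `1`. -/
def LargeStep [DecidableEq E] (I : GAP E m) (ε : ℝ) (K : ℕ) (M : Fin m → ℝ)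
    (s s' : State E m) : Prop :=
  ∃ i j k, 1 ≤ k ∧ I.IsCandidate ε K M s i j k ∧
    (∀ i' j' k', 1 ≤ k' → I.IsCandidate ε K M s i' j' k' → I.weight i j ≤ I.weight i' j') ∧
    s' = s.query I i j k

/-- The body of the second loop: query an allowed pair of maximal density, among all pairs in
buckets of index `0`. -/
def SmallStep [DecidableEq E] (I : GAP E m) (ε : ℝ) (K : ℕ) (M : Fin m → ℝ)
    (s s' : State E m) : Prop :=
  ∃ i j, I.IsCandidate ε K M s i j 0 ∧
    (∀ i' j', I.IsCandidate ε K M s i' j' 0 → I.density i' j' ≤ I.density i j) ∧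
    s' = s.query I i j 0

/-- The loop with body `step`, run until `step` is impossible, can lead from `s` to `s'`. -/
def Loop {σ : Type*} (step : σ → σ → Prop) (s s' : σ) : Prop :=
  Relation.ReflTransGen step s s' ∧ ∀ t, ¬ step s' t

/-- One round, from the query set `Q` to the query set `Q'`. -/
def Round [DecidableEq E] (I : GAP E m) (ε p : ℝ) (K : ℕ) (M : Fin m → ℝ)
    (Q Q' : Finset E) : Prop :=
  ∃ s₁ s₂ : State E m,
    Loop (I.LargeStep ε K M) ⟨Q, fun j _ => tau (ε ^ 2) / p * I.cap j⟩ s₁ ∧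
    Loop (I.SmallStep ε K M) s₁ s₂ ∧ s₂.queried = Q'

/-- `n` consecutive rounds. -/
def Rounds [DecidableEq E] (I : GAP E m) (ε p : ℝ) (K : ℕ) (M : Fin m → ℝ) :
    ℕ → Finset E → Finset E → Prop
  | 0, Q, Q' => Q = Q'
  | n + 1, Q, Q' => ∃ Q₁, Rounds I ε p K M n Q Q₁ ∧ Round I ε p K M Q₁ Q'

/-- `Q` is a possible output of the algorithm, under some way to break ties: it starts from the
empty query set and makes `α - 1` rounds, where `α = ⌈1 / ε⌉`. -/
def IsOutput [DecidableEq E] (I : GAP E m) (ε p : ℝ) (K : ℕ) (M : Fin m → ℝ)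
    (Q : Finset E) : Prop :=
  Rounds I ε p K M (⌈1 / ε⌉₊ - 1) ∅ Q

end GAP

/-! Value. Fix an optimal assignment `O R` for every active set `R` and let `Z` be the expected
optimum. The expected value of the pairs of `O R` whose item has already been queried starts at or
above `0`, never exceeds `Z`, and telescopes over the rounds. Hence in some round, leading from `Q`
to `Q'`, it grows by at most an average share, of order `ε Z`. In that round keep the pairs with
items in `Q`, give up those with items in `Q' \ Q`, and replace those with items outside `Q'`.

Replacement works bucket by bucket. If an item that fits stays unqueried, each of its buckets has
absorbed weight `τ C_j / p` from items preferred over it (`Round.spec`), so with probability at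
least `1 - ε²` the active part of the bucket weighs at least `C_j` (`expect_indicator_ge`). In a
regular bucket this part supplies equally many items that are no heavier and at most a factor `1 +
ε²` less valuable. In bucket `0` a density argument loses at most one item, of value at most `ε²
M_j`, and these losses sum to `ε² Z`. A super bucket cannot be exhausted: an active item of value at
least `Z / ε` would then be too likely (`RoundSpec.not_inBucket_super`). Since `O R` depends on all
of `R`, the active items in `Q' \ Q` are resampled independently (`expect_resample`); the items kept
and replaced lie outside this set, the replacements inside it. The combination is
`RoundSpec.le_bestValue`, averaged in `RoundSpec.expect_opt_ge`.

Degree. A bucket is overdrawn by at most one item, so each round loads knapsack `j` by at most `(K +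
2)(τ / p + 1) C_j` (`RoundSpec.load_le_total`). Next-fit (`exists_bins`) splits the total load into
few bins of capacity `C_j`; the bins of equal number over all knapsacks form one valid assignment,
so a multiple of the indicator of `Q` is a convex combination of feasible indicators. -/

namespace PackingProblem

/-- The two sets exchange their intersections with `N`. -/
def exchange {E : Type*} [DecidableEq E] (N : Finset E) (x : Finset E × Finset E) : Finset E × Finset E :=
  (x.1 \ N ∪ x.2 ∩ N, x.2 \ N ∪ x.1 ∩ N)

theorem exchange_involutive {E : Type*} [DecidableEq E] (N : Finset E) : Function.Involutive (exchange N) := by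
  rintro ⟨A, B⟩
  refine Prod.ext ?_ ?_ <;>
  · ext i
    simp only [exchange, Finset.mem_union, Finset.mem_sdiff, Finset.mem_inter]
    tauto

/-! ### Expectation over the random active set. -/

section Expectation

variable {E : Type*} [Fintype E] [DecidableEq E]

/-- Independence in the form needed for moment generating functions; `a = 1` gives total mass one.
-/
theorem expect_prod (p : ℝ) (a : E → ℝ) :
    expect p (fun R => ∏ i, if i ∈ R then a i else 1) = ∏ i, (1 - p + p * a i) := by
  have h := Finset.prod_add (fun i => p * a i) (fun _ : E => 1 - p) Finset.univ
  have h2 : ∏ i, (1 - p + p * a i) = ∏ i, (p * a i + (1 - p)) :=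
    Finset.prod_congr rfl fun i _ => add_comm _ _
  rw [h2, h, Finset.powerset_univ]
  refine Finset.sum_congr rfl fun R _ => ?_
  rw [← Finset.prod_mul_distrib, ← Finset.compl_eq_univ_sdiff,
    ← Finset.prod_mul_prod_compl R]
  congr 1
  · exact Finset.prod_congr rfl fun i hi => by simp [hi]
  · exact Finset.prod_congr rfl fun i hi => by simp [Finset.mem_compl.1 hi]

theorem expect_const (p c : ℝ) : expect p (fun _ : Finset E => c) = c := by
  have h := expect_prod (E := E) p (fun _ => 1)
  simp only [ite_self, Finset.prod_const_one, mul_one, sub_add_cancel, expect] at h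
  rw [expect, ← Finset.sum_mul, h, one_mul]

theorem expect_add (p : ℝ) (f g : Finset E → ℝ) :
    expect p (fun R => f R + g R) = expect p f + expect p g := by
  simp only [expect, mul_add, Finset.sum_add_distrib]

theorem expect_mul_left (p c : ℝ) (f : Finset E → ℝ) :
    expect p (fun R => c * f R) = c * expect p f := by
  simp only [expect, Finset.mul_sum]
  exact Finset.sum_congr rfl fun R _ => by ring

theorem expect_sub (p : ℝ) (f g : Finset E → ℝ) :
    expect p (fun R => f R - g R) = expect p f - expect p g := by
  simp only [expect, mul_sub, Finset.sum_sub_distrib]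

theorem expect_sum {ι : Type*} (s : Finset ι) (p : ℝ) (f : ι → Finset E → ℝ) :
    expect p (fun R => ∑ x ∈ s, f x R) = ∑ x ∈ s, expect p (f x) := by
  simp only [expect, Finset.mul_sum]
  exact Finset.sum_comm

theorem prob_nonneg {p : ℝ} (h0 : 0 ≤ p) (h1 : p ≤ 1) (R : Finset E) :
    0 ≤ ∏ i : E, if i ∈ R then p else 1 - p :=
  Finset.prod_nonneg fun i _ => by split_ifs <;> linarith

theorem expect_mono {p : ℝ} (h0 : 0 ≤ p) (h1 : p ≤ 1) {f g : Finset E → ℝ}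
    (h : ∀ R, f R ≤ g R) : expect p f ≤ expect p g :=
  Finset.sum_le_sum fun R _ => mul_le_mul_of_nonneg_left (h R) (prob_nonneg h0 h1 R)

theorem expect_nonneg {p : ℝ} (h0 : 0 ≤ p) (h1 : p ≤ 1) {f : Finset E → ℝ}
    (h : ∀ R, 0 ≤ f R) : 0 ≤ expect p f :=
  Finset.sum_nonneg fun R _ => mul_nonneg (prob_nonneg h0 h1 R) (h R)

/-- Resampling the part of the random set inside `N` does not change its distribution. -/
theorem expect_resample (p : ℝ) (N : Finset E) (g : Finset E → ℝ) :
    expect p g = expect p (fun A => expect p (fun B => g (A \ N ∪ B ∩ N))) := by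
  have h1 : expect p g = expect p (fun A => expect p (fun _ : Finset E => g A)) := by
    simp only [expect_const]
  rw [h1]
  simp only [expect, Finset.mul_sum]
  rw [← Finset.sum_product', ← Finset.sum_product', Finset.univ_product_univ]
  -- Swapping the coordinates in `N` between two independent copies preserves the product weight,
  -- because it only permutes its factors.
  refine Fintype.sum_equiv (Function.Involutive.toPerm _ (exchange_involutive N)) _ _ ?_
  rintro ⟨A, B⟩
  simp only [Function.Involutive.coe_toPerm]
  have hA : (exchange N (A, B)).1 \ N ∪ (exchange N (A, B)).2 ∩ N = A :=
    congrArg Prod.fst (exchange_involutive N (A, B))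
  rw [hA, ← mul_assoc, ← mul_assoc, ← Finset.prod_mul_distrib, ← Finset.prod_mul_distrib]
  congr 1
  refine Finset.prod_congr rfl fun i _ => ?_
  by_cases hi : i ∈ N <;> simp [exchange, hi, mul_comm]

end Expectation

/-! ### A Chernoff bound for the lower tail. -/

section Concentration

theorem log_inv_sq_ge {ε : ℝ} (h0 : 0 < ε) (h1 : ε < 1 / 6) : 3 ≤ Real.log (1 / ε ^ 2) := by
  rw [Real.le_log_iff_exp_le (by positivity), le_div_iff₀ (by positivity)]
  have h3 : Real.exp 3 < 36 := by
    have := Real.exp_one_lt_d9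
    have h : Real.exp 3 = Real.exp 1 ^ 3 := by rw [← Real.exp_nat_mul]; norm_num
    rw [h]
    calc Real.exp 1 ^ 3 ≤ 2.7182818286 ^ 3 := by gcongr
      _ < 36 := by norm_num
  nlinarith [Real.exp_pos 3]

theorem le_tau {ε : ℝ} (h0 : 0 < ε) (h1 : ε < 1 / 6) :
    1 + 2 * Real.log (1 / ε ^ 2) ≤ GAP.tau (ε ^ 2) := by
  have h3 := log_inv_sq_ge h0 h1
  have h : Real.log (1 / ε ^ 2) ≤
      Real.sqrt (Real.log (1 / ε ^ 2) ^ 2 + 2 * Real.log (1 / ε ^ 2)) :=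
    Real.le_sqrt_of_sq_le (by linarith)
  unfold GAP.tau
  linarith

/-- The left side is the Chernoff bound for falling below `1` when the mean is `τ`. The linear bound
`τ ≥ 1 + 2 log (1 / ε²)` suffices, with `log τ` estimated by its tangent at `4`. -/
theorem tau_mul_exp_le {ε : ℝ} (h0 : 0 < ε) (h1 : ε < 1 / 6) :
    GAP.tau (ε ^ 2) * Real.exp (1 - GAP.tau (ε ^ 2)) ≤ ε ^ 2 := by
  have h3 := log_inv_sq_ge h0 h1
  have ht := le_tau h0 h1
  set τ := GAP.tau (ε ^ 2)
  have hτ : 0 < τ := by linarith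
  have hlog : Real.log τ ≤ τ / 4 - 1 + 2 * Real.log 2 := by
    have h := Real.log_le_sub_one_of_pos (show 0 < τ / 4 by positivity)
    rw [Real.log_div hτ.ne' (by norm_num), show (4 : ℝ) = 2 ^ 2 by norm_num, Real.log_pow] at h
    push_cast at h
    linarith
  have h2 := Real.log_two_lt_d9
  have hε : Real.exp (-Real.log (1 / ε ^ 2)) = ε ^ 2 := by
    rw [Real.exp_neg, Real.exp_log (by positivity)]
    simp
  calc τ * Real.exp (1 - τ) = Real.exp (Real.log τ + (1 - τ)) := by
        rw [Real.exp_add, Real.exp_log hτ]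
    _ ≤ Real.exp (-Real.log (1 / ε ^ 2)) := Real.exp_le_exp.2 (by linarith)
    _ = ε ^ 2 := hε

/-- Convexity: on `[0, 1]` the function lies below its chord. -/
theorem exp_neg_mul_le {w : ℝ} (l : ℝ) (h0 : 0 ≤ w) (h1 : w ≤ 1) :
    Real.exp (-(l * w)) ≤ 1 - w * (1 - Real.exp (-l)) := by
  have h := convexOn_exp.2 (Set.mem_univ 0) (Set.mem_univ (-l)) (sub_nonneg.2 h1) h0
    (by ring)
  simp only [smul_eq_mul, mul_zero, zero_add, Real.exp_zero, mul_one] at h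
  calc Real.exp (-(l * w)) = Real.exp (w * -l) := by ring_nf
    _ ≤ _ := h
    _ = _ := by ring

variable {E : Type*} [Fintype E] [DecidableEq E]

/-- Lower tail bound: a random part of a set of total weight `τ / p * C` has weight at least `C`
with high probability. -/
theorem expect_indicator_ge {ε p C : ℝ} (h0 : 0 < ε) (h1 : ε < 1 / 6) (hp0 : 0 < p) (hp1 : p ≤ 1)
    (hC : 0 < C) (N : Finset E) (w : E → ℝ) (hw0 : ∀ i ∈ N, 0 ≤ w i) (hw1 : ∀ i ∈ N, w i ≤ C)
    (hN : GAP.tau (ε ^ 2) / p * C ≤ ∑ i ∈ N, w i) :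
    1 - ε ^ 2 ≤ expect p (fun R => if C ≤ ∑ i ∈ R ∩ N, w i then 1 else 0) := by
  have h3 := log_inv_sq_ge h0 h1
  have ht := le_tau h0 h1
  have hfin := tau_mul_exp_le h0 h1
  set τ := GAP.tau (ε ^ 2)
  have hτ : 1 < τ := by linarith
  have hτ0 : 0 < τ := by linarith
  have hτexp : Real.exp (-Real.log τ) = 1 / τ := by rw [Real.exp_neg, Real.exp_log hτ0, one_div]
  -- The exponent that minimises the bound `exp (l - τ (1 - exp (-l)))`.
  set l := Real.log τ with hl
  have hl0 : 0 < l := Real.log_pos hτ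
  let a : E → ℝ := fun i => if i ∈ N then Real.exp (-(l * (w i / C))) else 1
  -- Pointwise form of Markov's inequality for `exp (-l X / C)`, where `X` is the active weight.
  have hpt : ∀ R : Finset E, 1 - (if C ≤ ∑ i ∈ R ∩ N, w i then (1 : ℝ) else 0) ≤
      τ * ∏ i, if i ∈ R then a i else 1 := by
    intro R
    have hprod : (∏ i, if i ∈ R then a i else 1) =
        Real.exp (-(l * ((∑ i ∈ R ∩ N, w i) / C))) := by
      rw [Finset.sum_div, Finset.mul_sum, ← Finset.sum_neg_distrib, Real.exp_sum]
      rw [← Finset.prod_subset (Finset.subset_univ (R ∩ N))]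
      · refine Finset.prod_congr rfl fun i hi => ?_
        simp [a, (Finset.mem_inter.1 hi).1, (Finset.mem_inter.1 hi).2]
      · intro i _ hi
        rw [Finset.mem_inter, not_and] at hi
        split_ifs with h
        · simp [a, hi h]
        · rfl
    rw [hprod]
    split_ifs with h
    · rw [sub_self]; positivity
    · rw [sub_zero]
      have h' : (∑ i ∈ R ∩ N, w i) / C ≤ 1 := (div_le_one hC).2 (not_le.1 h).le
      have h4 : Real.exp (-l) ≤ Real.exp (-(l * ((∑ i ∈ R ∩ N, w i) / C))) :=
        Real.exp_le_exp.2 (by nlinarith)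
      calc (1 : ℝ) = τ * Real.exp (-l) := by rw [hτexp]; field_simp
        _ ≤ _ := by gcongr
  have hprod : ∏ i, (1 - p + p * a i) ≤ Real.exp (1 - τ) := by
    have hi : ∀ i, 1 - p + p * a i ≤
        Real.exp (if i ∈ N then -(p * (w i / C * (1 - 1 / τ))) else 0) := by
      intro i
      by_cases hi : i ∈ N
      · simp only [a, hi, if_true]
        have h5 := exp_neg_mul_le l (div_nonneg (hw0 i hi) hC.le) ((div_le_one hC).2 (hw1 i hi))
        rw [hτexp] at h5
        have h6 := Real.add_one_le_exp (-(p * (w i / C * (1 - 1 / τ))))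
        nlinarith [mul_le_mul_of_nonneg_left h5 hp0.le]
      · simp [a, hi]
    have hi0 : ∀ i, 0 ≤ 1 - p + p * a i := by
      intro i
      have : 0 ≤ a i := by simp only [a]; split_ifs <;> positivity
      have := mul_nonneg hp0.le this
      linarith
    calc ∏ i, (1 - p + p * a i) ≤
          ∏ i, Real.exp (if i ∈ N then -(p * (w i / C * (1 - 1 / τ))) else 0) :=
          Finset.prod_le_prod (fun i _ => hi0 i) fun i _ => hi i
      _ = Real.exp (-(p / C * (1 - 1 / τ) * ∑ i ∈ N, w i)) := by
          rw [← Real.exp_sum, ← Finset.sum_filter, Finset.mul_sum, ← Finset.sum_neg_distrib]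
          congr 1
          rw [Finset.filter_mem_eq_inter, Finset.univ_inter]
          exact Finset.sum_congr rfl fun i _ => by ring
      _ ≤ Real.exp (1 - τ) := by
          refine Real.exp_le_exp.2 ?_
          have h7 : 0 ≤ p / C * (1 - 1 / τ) := by
            have : 1 / τ ≤ 1 := (div_le_one hτ0).2 hτ.le
            have := sub_nonneg.2 this
            positivity
          have h8 := mul_le_mul_of_nonneg_left hN h7
          have h9 : p / C * (1 - 1 / τ) * (τ / p * C) = τ - 1 := by field_simp
          linarith
  have hmain := expect_mono hp0.le hp1 hpt
  rw [expect_sub, expect_const, expect_mul_left, expect_prod] at hmain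
  have := mul_le_mul_of_nonneg_left hprod hτ0.le
  linarith

end Concentration

end PackingProblem

namespace GAP

/-! ### The optimum of an instance: attainment and monotonicity. -/

section Optimum

variable {E : Type*} [Fintype E] [DecidableEq E] {m : ℕ}

theorem mem_assignmentsIn {I : GAP E m} {S : Finset E} {A : Finset (E × Fin m)} :
    A ∈ I.assignmentsIn S ↔ I.IsValid A ∧ items A ⊆ S := by
  simp [assignmentsIn]

theorem totalValue_le_bestValue {I : GAP E m} {S : Finset E} {A : Finset (E × Fin m)}
    (hA : I.IsValid A) (hS : items A ⊆ S) : I.totalValue A ≤ I.bestValue S :=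
  Finset.le_sup' I.totalValue (mem_assignmentsIn.2 ⟨hA, hS⟩)

theorem exists_bestValue (I : GAP E m) (S : Finset E) :
    ∃ A, I.IsValid A ∧ items A ⊆ S ∧ I.totalValue A = I.bestValue S := by
  obtain ⟨A, hA, h⟩ := Finset.exists_mem_eq_sup' (I.assignmentsIn_nonempty S) I.totalValue
  rw [mem_assignmentsIn] at hA
  exact ⟨A, hA.1, hA.2, h.symm⟩

theorem bestValue_mono (I : GAP E m) {S T : Finset E} (h : S ⊆ T) :
    I.bestValue S ≤ I.bestValue T := by
  obtain ⟨A, hA, hS, hv⟩ := I.exists_bestValue S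
  exact hv ▸ totalValue_le_bestValue hA (hS.trans h)

theorem opt_toPacking (I : GAP E m) (X : Finset E) : I.toPacking.opt X = I.bestValue X := by
  classical
  refine le_antisymm (Finset.sup'_le _ _ fun S hS => ?_) ?_
  · simp only [PackingProblem.feasibleIn, Finset.mem_filter, Finset.mem_powerset] at hS
    exact I.bestValue_mono hS.1
  · obtain ⟨A, hA, hX, hv⟩ := I.exists_bestValue X
    rw [← hv]
    refine (totalValue_le_bestValue hA subset_rfl).trans
      (Finset.le_sup' (f := I.bestValue) (b := items A) ?_)
    simp only [PackingProblem.feasibleIn, Finset.mem_filter, Finset.mem_powerset]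
    exact ⟨hX, A, hA, rfl⟩

theorem bestValue_nonneg (I : GAP E m) (X : Finset E) : 0 ≤ I.bestValue X :=
  I.toPacking.objective_nonneg X

theorem opt_mono (I : GAP E m) {S T : Finset E} (h : S ⊆ T) :
    I.toPacking.opt S ≤ I.toPacking.opt T := by
  simpa only [opt_toPacking] using I.bestValue_mono h

theorem opt_nonneg (I : GAP E m) (X : Finset E) : 0 ≤ I.toPacking.opt X := by
  rw [opt_toPacking]
  exact I.bestValue_nonneg X

end Optimum

end GAP

namespace GAP

theorem InBucket.le {E : Type*} {m : ℕ} {I : GAP E m} {ε : ℝ} {K : ℕ} {M : Fin m → ℝ} {i : E} {j : Fin m} {k : ℕ}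
    (h : I.InBucket ε K M i j k) : k ≤ K + 1 := by
  rcases h with h | h | h <;> omega

/-! ### Steps exist whenever candidates do, and all loops terminate. -/

section Existence

variable {E : Type*} [Fintype E] [DecidableEq E] {m : ℕ}

theorem exists_largeStep {I : GAP E m} {ε : ℝ} {K : ℕ} {M : Fin m → ℝ} {s : State E m}
    {i : E} {j : Fin m} {k : ℕ} (hk : 1 ≤ k) (h : I.IsCandidate ε K M s i j k) :
    ∃ s', I.LargeStep ε K M s s' := by
  classical
  let T : Finset (E × Fin m × ℕ) := (Finset.univ ×ˢ Finset.univ ×ˢ Finset.range (K + 2)).filter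
    fun x => 1 ≤ x.2.2 ∧ I.IsCandidate ε K M s x.1 x.2.1 x.2.2
  have hT : ∀ i j k, 1 ≤ k → I.IsCandidate ε K M s i j k → (i, j, k) ∈ T := by
    intro i j k hk h
    have := h.2.1.le
    simp only [T, Finset.mem_filter, Finset.mem_product, Finset.mem_univ, Finset.mem_range,
      true_and]
    exact ⟨by omega, hk, h⟩
  obtain ⟨x, hx, hmin⟩ := T.exists_min_image (fun x => I.weight x.1 x.2.1) ⟨_, hT i j k hk h⟩
  have hx' := (Finset.mem_filter.1 hx).2
  exact ⟨_, x.1, x.2.1, x.2.2, hx'.1, hx'.2,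
    fun i' j' k' hk' h' => hmin _ (hT i' j' k' hk' h'), rfl⟩

theorem exists_smallStep {I : GAP E m} {ε : ℝ} {K : ℕ} {M : Fin m → ℝ} {s : State E m}
    {i : E} {j : Fin m} (h : I.IsCandidate ε K M s i j 0) :
    ∃ s', I.SmallStep ε K M s s' := by
  classical
  let T : Finset (E × Fin m) := Finset.univ.filter fun x => I.IsCandidate ε K M s x.1 x.2 0
  have hT : ∀ i j, I.IsCandidate ε K M s i j 0 → (i, j) ∈ T := fun i j h => by simpa [T] using h
  obtain ⟨x, hx, hmax⟩ := T.exists_max_image (fun x => I.density x.1 x.2) ⟨_, hT i j h⟩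
  exact ⟨_, x.1, x.2, (Finset.mem_filter.1 hx).2, fun i' j' h' => hmax _ (hT i' j' h'), rfl⟩

/-- The number of unqueried items decreases strictly, so the loop stops. -/
theorem exists_loop {step : State E m → State E m → Prop}
    (hstep : ∀ s s', step s s' → s.queried ⊂ s'.queried) (s : State E m) :
    ∃ s', Loop step s s' := by
  induction hn : s.queriedᶜ.card using Nat.strong_induction_on generalizing s with
  | _ n ih =>
    by_cases h : ∃ t, step s t
    · obtain ⟨t, ht⟩ := h
      obtain ⟨s', h1, h2⟩ := ih _ (hn ▸ Finset.card_lt_card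
        (Finset.compl_ssubset_compl.2 (hstep s t ht))) t rfl
      exact ⟨s', Relation.ReflTransGen.head ht h1, h2⟩
    · exact ⟨s, Relation.ReflTransGen.refl, not_exists.1 h⟩

theorem exists_round (I : GAP E m) (ε p : ℝ) (K : ℕ) (M : Fin m → ℝ) (Q : Finset E) :
    ∃ Q', I.Round ε p K M Q Q' := by
  obtain ⟨s₁, h₁⟩ := exists_loop (step := I.LargeStep ε K M)
    (by
      rintro s _ ⟨i, j, k, _, hi, _, rfl⟩
      exact Finset.ssubset_insert hi.1) ⟨Q, fun j _ => tau (ε ^ 2) / p * I.cap j⟩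
  obtain ⟨s₂, h₂⟩ := exists_loop (step := I.SmallStep ε K M)
    (by
      rintro s _ ⟨i, j, hi, _, rfl⟩
      exact Finset.ssubset_insert hi.1) s₁
  exact ⟨_, s₁, s₂, h₁, h₂, rfl⟩

theorem exists_rounds (I : GAP E m) (ε p : ℝ) (K : ℕ) (M : Fin m → ℝ) (n : ℕ) (Q : Finset E) :
    ∃ Q', I.Rounds ε p K M n Q Q' := by
  induction n with
  | zero => exact ⟨Q, rfl⟩
  | succ n ih =>
    obtain ⟨Q₁, h₁⟩ := ih
    obtain ⟨Q', h'⟩ := I.exists_round ε p K M Q₁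
    exact ⟨Q', Q₁, h₁, h'⟩

end Existence

/-! ### The invariant of a round and its consequences. -/

section Algorithm

variable {E : Type*} [DecidableEq E] {m : ℕ}

/-- The items of `S` that `φ` sends to the bucket `(j, k)`. -/
def bucketPart (φ : E → Fin m × ℕ) (S : Finset E) (j : Fin m) (k : ℕ) : Finset E :=
  S.filter fun i => φ i = (j, k)

/-- The query `n` is preferred over `i` in a bucket of index `k` of `j`. -/
def Dominates (I : GAP E m) (j : Fin m) (k : ℕ) (n i : E) : Prop :=
  (1 ≤ k → I.weight n j ≤ I.weight i j) ∧ (k = 0 → I.density i j ≤ I.density n j)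

/-- The state `s` is reachable within a round that starts from the query set `Q` with bucket
capacities `β j`, where `φ` tells through which buckets the items are queried. -/
structure RoundInv (I : GAP E m) (ε : ℝ) (K : ℕ) (M : Fin m → ℝ) (β : Fin m → ℝ)
    (Q : Finset E) (φ : E → Fin m × ℕ) (s : State E m) : Prop where
  subset : Q ⊆ s.queried
  inBucket : ∀ i ∈ s.queried \ Q, I.InBucket ε K M i (φ i).1 (φ i).2
  weight_le : ∀ i ∈ s.queried \ Q, I.weight i (φ i).1 ≤ I.cap (φ i).1
  rem_eq : ∀ j k, s.rem j k = β j - ∑ i ∈ bucketPart φ (s.queried \ Q) j k, I.weight i j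
  rem_ge : ∀ j k, - I.cap j ≤ s.rem j k
  dominates : ∀ j k, ∀ i ∉ s.queried, I.InBucket ε K M i j k → I.weight i j ≤ I.cap j →
    ∀ n ∈ bucketPart φ (s.queried \ Q) j k, I.Dominates j k n i

theorem bucketPart_update_insert {φ : E → Fin m × ℕ} {S : Finset E} {i : E} (hi : i ∉ S)
    (j : Fin m) (k : ℕ) (j' : Fin m) (k' : ℕ) :
    bucketPart (Function.update φ i (j, k)) (insert i S) j' k' =
      if j' = j ∧ k' = k then insert i (bucketPart φ S j' k') else bucketPart φ S j' k' := by
  ext x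
  by_cases hx : x = i
  · subst hx
    split_ifs with h
    · simp [bucketPart, h.1, h.2]
    · simp only [bucketPart, Finset.mem_filter, Finset.mem_insert, Function.update_self,
        Prod.mk.injEq]
      constructor
      · rintro ⟨_, h1, h2⟩
        exact absurd ⟨h1.symm, h2.symm⟩ h
      · rintro ⟨h1, _⟩
        exact absurd h1 hi
  · split_ifs <;> simp [bucketPart, hx]

/-- An eligible item that remains unqueried was itself a candidate for this bucket, so the selection
rule gives dominance. The bucket was positive before the step, so subtracting a weight of at most
`C_j` leaves at least `-C_j`. -/
theorem RoundInv.query {I : GAP E m} {ε : ℝ} {K : ℕ} {M : Fin m → ℝ} {β : Fin m → ℝ}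
    {Q : Finset E} {φ : E → Fin m × ℕ} {s : State E m} (hs : I.RoundInv ε K M β Q φ s)
    {i : E} {j : Fin m} {k : ℕ} (hi : I.IsCandidate ε K M s i j k)
    (hdom : ∀ i', I.IsCandidate ε K M s i' j k → I.Dominates j k i i') :
    I.RoundInv ε K M β Q (Function.update φ i (j, k)) (s.query I i j k) := by
  obtain ⟨hiq, hib, hiw, hirem⟩ := hi
  have hiQ : i ∉ Q := fun h => hiq (hs.subset h)
  have hiS : i ∉ s.queried \ Q := fun h => hiq (Finset.mem_sdiff.1 h).1
  have hsd : (s.query I i j k).queried \ Q = insert i (s.queried \ Q) :=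
    Finset.insert_sdiff_of_notMem _ hiQ
  have hrem : ∀ j' k', (s.query I i j k).rem j' k' =
      if j' = j ∧ k' = k then s.rem j k - I.weight i j else s.rem j' k' := fun _ _ => rfl
  refine ⟨hs.subset.trans (Finset.subset_insert _ _), ?_, ?_, ?_, ?_, ?_⟩
  · rw [hsd]
    intro x hx
    rcases Finset.mem_insert.1 hx with rfl | hx
    · simpa using hib
    · have : x ≠ i := fun h => hiS (h ▸ hx)
      rw [Function.update_of_ne this]
      exact hs.inBucket x hx
  · rw [hsd]
    intro x hx
    rcases Finset.mem_insert.1 hx with rfl | hx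
    · simpa using hiw
    · have : x ≠ i := fun h => hiS (h ▸ hx)
      rw [Function.update_of_ne this]
      exact hs.weight_le x hx
  · intro j' k'
    rw [hsd, bucketPart_update_insert hiS, hrem]
    split_ifs with h
    · obtain ⟨rfl, rfl⟩ := h
      have hi' : i ∉ bucketPart φ (s.queried \ Q) j' k' := fun h => hiS (Finset.mem_filter.1 h).1
      rw [Finset.sum_insert hi', hs.rem_eq]
      ring
    · exact hs.rem_eq j' k'
  · intro j' k'
    rw [hrem]
    split_ifs with h
    · obtain ⟨rfl, rfl⟩ := h
      linarith
    · exact hs.rem_ge j' k'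
  · intro j' k' x hx hxb hxw n hn
    rw [hsd, bucketPart_update_insert hiS] at hn
    have hxq : x ∉ s.queried := fun h => hx (Finset.mem_insert_of_mem h)
    split_ifs at hn with h
    · obtain ⟨rfl, rfl⟩ := h
      rcases Finset.mem_insert.1 hn with rfl | hn
      · exact hdom x ⟨hxq, hxb, hxw, hirem⟩
      · exact hs.dominates _ _ x hxq hxb hxw n hn
    · exact hs.dominates _ _ x hxq hxb hxw n hn

theorem RoundInv.largeStep {I : GAP E m} {ε : ℝ} {K : ℕ} {M : Fin m → ℝ} {β : Fin m → ℝ}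
    {Q : Finset E} {s s' : State E m} (h : I.LargeStep ε K M s s')
    (hs : ∃ φ, I.RoundInv ε K M β Q φ s) : ∃ φ, I.RoundInv ε K M β Q φ s' := by
  obtain ⟨φ, hs⟩ := hs
  obtain ⟨i, j, k, hk, hi, hmin, rfl⟩ := h
  exact ⟨_, hs.query hi fun i' hi' => ⟨fun _ => hmin i' j k hk hi', fun h => by omega⟩⟩

theorem RoundInv.smallStep {I : GAP E m} {ε : ℝ} {K : ℕ} {M : Fin m → ℝ} {β : Fin m → ℝ}
    {Q : Finset E} {s s' : State E m} (h : I.SmallStep ε K M s s')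
    (hs : ∃ φ, I.RoundInv ε K M β Q φ s) : ∃ φ, I.RoundInv ε K M β Q φ s' := by
  obtain ⟨φ, hs⟩ := hs
  obtain ⟨i, j, hi, hmax, rfl⟩ := h
  exact ⟨_, hs.query hi fun i' hi' => ⟨fun h => by omega, fun _ => hmax i' j hi'⟩⟩

theorem RoundInv.init (I : GAP E m) (ε : ℝ) (K : ℕ) (M : Fin m → ℝ) {β : Fin m → ℝ}
    (hβ : ∀ j, 0 ≤ β j) (Q : Finset E) (φ : E → Fin m × ℕ) :
    I.RoundInv ε K M β Q φ ⟨Q, fun j _ => β j⟩ where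
  subset := subset_rfl
  inBucket := by simp
  weight_le := by simp
  rem_eq := by simp [bucketPart]
  rem_ge := fun j k => by
    have := hβ j
    have := I.cap_pos j
    simp only
    linarith
  dominates := by simp [bucketPart]

/-- Lets the exhaustion of the buckets of positive index, reached when the first loop stops, persist
to the end of the round. -/
theorem small_loop_frame {I : GAP E m} {ε : ℝ} {K : ℕ} {M : Fin m → ℝ} {s s' : State E m}
    (h : Relation.ReflTransGen (I.SmallStep ε K M) s s') :
    s.queried ⊆ s'.queried ∧ ∀ j k, 1 ≤ k → s'.rem j k = s.rem j k := by
  induction h with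
  | refl => exact ⟨subset_rfl, fun _ _ _ => rfl⟩
  | tail _ hstep ih =>
    obtain ⟨i, j, _, _, rfl⟩ := hstep
    refine ⟨ih.1.trans (Finset.subset_insert _ _), fun j' k hk => ?_⟩
    rw [← ih.2 j' k hk]
    exact if_neg fun h => by omega

/-- What a round with initial bucket capacities `β j` achieves: the new items are queried through
the buckets given by `φ`, and each bucket of an item that is not queried has been filled by items
that are preferred over it. -/
structure RoundSpec (I : GAP E m) (ε : ℝ) (K : ℕ) (M : Fin m → ℝ) (β : Fin m → ℝ)
    (Q Q' : Finset E) (φ : E → Fin m × ℕ) : Prop where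
  subset : Q ⊆ Q'
  inBucket : ∀ i ∈ Q' \ Q, I.InBucket ε K M i (φ i).1 (φ i).2
  weight_le : ∀ i ∈ Q' \ Q, I.weight i (φ i).1 ≤ I.cap (φ i).1
  load_le : ∀ j k, ∑ i ∈ bucketPart φ (Q' \ Q) j k, I.weight i j ≤ β j + I.cap j
  le_load : ∀ j k, ∀ i ∉ Q', I.InBucket ε K M i j k → I.weight i j ≤ I.cap j →
    β j ≤ ∑ i ∈ bucketPart φ (Q' \ Q) j k, I.weight i j
  dominates : ∀ j k, ∀ i ∉ Q', I.InBucket ε K M i j k → I.weight i j ≤ I.cap j →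
    ∀ n ∈ bucketPart φ (Q' \ Q) j k, I.Dominates j k n i

theorem tau_nonneg {x : ℝ} (h0 : 0 < x) (h1 : x ≤ 1) : 0 ≤ tau x := by
  have : 0 ≤ Real.log (1 / x) := Real.log_nonneg ((one_le_div h0).2 h1)
  unfold tau
  positivity

theorem Round.spec [Fintype E] {I : GAP E m} {ε p : ℝ} {K : ℕ} {M : Fin m → ℝ} {Q Q' : Finset E}
    (h : I.Round ε p K M Q Q') (hβ : ∀ j, 0 ≤ tau (ε ^ 2) / p * I.cap j) (hm : 0 < m) :
    ∃ φ, I.RoundSpec ε K M (fun j => tau (ε ^ 2) / p * I.cap j) Q Q' φ := by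
  obtain ⟨s₁, s₂, ⟨hl, hl'⟩, ⟨hs, hs'⟩, rfl⟩ := h
  have h0 : ∃ φ, I.RoundInv ε K M (fun j => tau (ε ^ 2) / p * I.cap j) Q φ
      ⟨Q, fun j _ => tau (ε ^ 2) / p * I.cap j⟩ :=
    -- Nothing has been queried in this round yet, so the initial map is arbitrary.
    ⟨fun _ => (⟨0, hm⟩, 0), RoundInv.init I ε K M hβ Q _⟩
  have h1 : ∃ φ, I.RoundInv ε K M (fun j => tau (ε ^ 2) / p * I.cap j) Q φ s₁ := by
    clear hl' hs hs'
    induction hl with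
    | refl => exact h0
    | tail _ hstep ih => exact RoundInv.largeStep hstep ih
  have h2 : ∃ φ, I.RoundInv ε K M (fun j => tau (ε ^ 2) / p * I.cap j) Q φ s₂ := by
    clear hs'
    induction hs with
    | refl => exact h1
    | tail _ hstep ih => exact RoundInv.smallStep hstep ih
  obtain ⟨φ, hφ⟩ := h2
  refine ⟨φ, hφ.subset, hφ.inBucket, hφ.weight_le, fun j k => ?_, fun j k i hi hb hw => ?_,
    hφ.dominates⟩
  · have h3 := hφ.rem_eq j k
    have h4 := hφ.rem_ge j k
    linarith
  · have h3 := hφ.rem_eq j k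
    suffices h : s₂.rem j k ≤ 0 by linarith
    -- With capacity left, the unqueried item would still be a candidate, and the responsible loop
    -- could not have stopped.
    by_contra! hpos
    rcases Nat.eq_zero_or_pos k with rfl | hk
    · obtain ⟨t, ht⟩ := exists_smallStep ⟨hi, hb, hw, hpos⟩
      exact hs' t ht
    · have hframe := small_loop_frame hs
      rw [hframe.2 j k hk] at hpos
      obtain ⟨t, ht⟩ := exists_largeStep hk ⟨fun h => hi (hframe.1 h), hb, hw, hpos⟩
      exact hl' t ht

end Algorithm

end GAP

/-! ### The degree: splitting the queried items into feasible sets. -/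

/-- Next-fit, with `n` the open bin. The potential `n * C` plus the open load grows by at most `2 *
w a`: a new bin is opened only if `a` and the open load together exceed `C`. -/
theorem exists_bins {E : Type*} [DecidableEq E] {w : E → ℝ} {C : ℝ} (hC : 0 ≤ C)
    (S : Finset E) (h0 : ∀ i ∈ S, 0 ≤ w i) (h1 : ∀ i ∈ S, w i ≤ C) :
    ∃ (g : E → ℕ) (n : ℕ), (∀ i ∈ S, g i ≤ n) ∧ (∀ b, ∑ i ∈ S with g i = b, w i ≤ C) ∧
      n * C + ∑ i ∈ S with g i = n, w i ≤ 2 * ∑ i ∈ S, w i := by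
  induction S using Finset.induction_on with
  | empty => exact ⟨fun _ => 0, 0, by simp, by simpa using hC, by simp⟩
  | insert a S ha ih =>
    obtain ⟨g, n, hg, hb, hn⟩ := ih (fun i hi => h0 i (Finset.mem_insert_of_mem hi))
      (fun i hi => h1 i (Finset.mem_insert_of_mem hi))
    have ha0 := h0 a (Finset.mem_insert_self _ _)
    have ha1 := h1 a (Finset.mem_insert_self _ _)
    have hsum : ∀ b c, ∑ i ∈ insert a S with Function.update g a c i = b, w i =
        (if c = b then w a else 0) + ∑ i ∈ S with g i = b, w i := by
      intro b c
      simp only [Finset.sum_filter]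
      rw [Finset.sum_insert ha, Function.update_self]
      congr 1
      refine Finset.sum_congr rfl fun i hi => ?_
      rw [Function.update_of_ne (ne_of_mem_of_not_mem hi ha)]
    have hempty : ∑ i ∈ S with g i = n + 1, w i = 0 := by
      refine Finset.sum_eq_zero fun i hi => ?_
      obtain ⟨h, h'⟩ := Finset.mem_filter.1 hi
      have := hg i h
      omega
    by_cases hfit : w a + ∑ i ∈ S with g i = n, w i ≤ C
    · refine ⟨Function.update g a n, n, fun i hi => ?_, fun b => ?_, ?_⟩
      · rcases Finset.mem_insert.1 hi with rfl | hi
        · simp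
        · rw [Function.update_of_ne (ne_of_mem_of_not_mem hi ha)]
          exact hg i hi
      · rw [hsum]
        split_ifs with h
        · exact h ▸ hfit
        · rw [zero_add]; exact hb b
      · rw [hsum, Finset.sum_insert ha, if_pos rfl]
        linarith
    · refine ⟨Function.update g a (n + 1), n + 1, fun i hi => ?_, fun b => ?_, ?_⟩
      · rcases Finset.mem_insert.1 hi with rfl | hi
        · simp
        · rw [Function.update_of_ne (ne_of_mem_of_not_mem hi ha)]
          exact (hg i hi).trans (Nat.le_succ n)
      · rw [hsum]
        split_ifs with h
        · rw [← h, hempty]; simpa using ha1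
        · rw [zero_add]; exact hb b
      · rw [hsum, Finset.sum_insert ha, if_pos rfl, hempty]
        push_cast
        linarith

namespace PackingProblem

theorem smul_indicatorVec_mem_polytope {E : Type*} [DecidableEq E] (P : PackingProblem E)
    (Q : Finset E) (g : E → ℕ) (n : ℕ) (hg : ∀ i ∈ Q, g i < n)
    (hP : ∀ b, (Q.filter fun i => g i = b) ∈ P.feasible) {d : ℝ} (hd : (n : ℝ) ≤ d) (hd0 : 0 < d) :
    (1 / d) • indicatorVec Q ∈ P.polytope := by
  have hconv : Convex ℝ P.polytope := convex_convexHull ℝ _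
  have hmem : ∀ S ∈ P.feasible, indicatorVec S ∈ P.polytope := fun S hS =>
    subset_convexHull ℝ _ ⟨S, hS, rfl⟩
  -- The extra index `n` carries the empty set, which absorbs the remaining mass `1 - n / d`.
  have hsum : (1 / d) • indicatorVec Q = ∑ b ∈ Finset.range (n + 1),
      (if b = n then 1 - n / d else 1 / d) •
        indicatorVec (if b = n then ∅ else Q.filter fun i => g i = b) := by
    rw [Finset.sum_range_succ]
    ext i
    have h0 : indicatorVec (∅ : Finset E) i = 0 := by simp [indicatorVec]
    have hne : ∀ b ∈ Finset.range n, b ≠ n := fun b hb => (Finset.mem_range.1 hb).ne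
    rw [Finset.sum_congr rfl fun b hb => by rw [if_neg (hne b hb), if_neg (hne b hb)]]
    simp only [if_true, Pi.add_apply, Pi.smul_apply, Finset.sum_apply, h0, smul_eq_mul, mul_zero,
      add_zero]
    rw [← Finset.mul_sum]
    congr 1
    by_cases hi : i ∈ Q
    · simp [indicatorVec, hi, hg i hi]
    · simp [indicatorVec, hi]
  rw [hsum]
  refine hconv.sum_mem (fun b _ => ?_) ?_ (fun b _ => ?_)
  · split_ifs
    · exact sub_nonneg.2 ((div_le_one hd0).2 hd)
    · positivity
  · rw [Finset.sum_range_succ, if_pos rfl, Finset.sum_congr rfl fun b hb =>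
      if_neg (Finset.mem_range.1 hb).ne]
    simp only [Finset.sum_const, Finset.card_range, nsmul_eq_mul]
    ring
  · split_ifs
    · exact hmem _ P.empty_feasible
    · exact hmem _ (hP b)

end PackingProblem

namespace GAP

theorem RoundSpec.load_le_total {E : Type*} [DecidableEq E] {m : ℕ} {I : GAP E m} {ε : ℝ} {K : ℕ} {M : Fin m → ℝ}
    {β : Fin m → ℝ} {Q Q' : Finset E} {φ : E → Fin m × ℕ} (h : I.RoundSpec ε K M β Q Q' φ)
    (j : Fin m) :
    ∑ i ∈ Q' \ Q with (φ i).1 = j, I.weight i j ≤ (K + 2) * (β j + I.cap j) := by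
  rw [← Finset.sum_fiberwise_of_maps_to (t := Finset.range (K + 2)) (g := fun i => (φ i).2)
    (fun i hi => by
      have := (h.inBucket i (Finset.mem_filter.1 hi).1).le
      exact Finset.mem_range.2 (by omega))]
  have hk : ∀ k ∈ Finset.range (K + 2), ∑ i ∈ (Q' \ Q).filter (fun i => (φ i).1 = j) with
      (φ i).2 = k, I.weight i j ≤ β j + I.cap j := by
    intro k _
    refine le_of_eq_of_le ?_ (h.load_le j k)
    rw [Finset.filter_filter]
    refine Finset.sum_congr (Finset.filter_congr fun i _ => ?_) fun _ _ => rfl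
    rw [Prod.ext_iff]
  refine (Finset.sum_le_sum hk).trans_eq ?_
  rw [Finset.sum_const, Finset.card_range, nsmul_eq_mul]
  push_cast
  ring

section Degree

variable {E : Type*} [Fintype E] [DecidableEq E] {m : ℕ}

theorem smul_indicatorVec_mem_polytope (I : GAP E m) (Q : Finset E) (σ : E → Fin m)
    (hw : ∀ i ∈ Q, I.weight i (σ i) ≤ I.cap (σ i)) {D : ℝ} (hD : 0 ≤ D)
    (hload : ∀ j, ∑ i ∈ Q with σ i = j, I.weight i j ≤ D * I.cap j) {d : ℝ}
    (hd : 2 * D + 2 ≤ d) :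
    (1 / d) • PackingProblem.indicatorVec Q ∈ I.toPacking.polytope := by
  have hbins := fun j => exists_bins (I.cap_pos j).le (Q.filter fun i => σ i = j)
    (w := fun i => I.weight i j) (fun i _ => I.weight_nonneg i j) (fun i hi => by
      obtain ⟨h, rfl⟩ := Finset.mem_filter.1 hi
      exact hw i h)
  choose g n hg hb hn using hbins
  have hn' : ∀ j, (n j : ℝ) ≤ 2 * D := by
    intro j
    have h1 := hn j
    have h2 : 0 ≤ ∑ i ∈ Q.filter (fun i => σ i = j) with g j i = n j, I.weight i j :=
      Finset.sum_nonneg fun i _ => I.weight_nonneg i j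
    have h3 : (n j : ℝ) * I.cap j ≤ 2 * D * I.cap j := by linarith [hload j]
    exact le_of_mul_le_mul_right h3 (I.cap_pos j)
  refine PackingProblem.smul_indicatorVec_mem_polytope _ Q (fun i => g (σ i) i) (⌊2 * D⌋₊ + 1)
    (fun i hi => ?_) (fun b => ?_) ?_ (by linarith)
  · have h1 := hg (σ i) i (Finset.mem_filter.2 ⟨hi, rfl⟩)
    have h2 := Nat.le_floor (hn' (σ i))
    omega
  -- Bin number `b` of every knapsack is used simultaneously, so the number of classes does not grow
  -- with `m`.
  · refine ⟨(Q.filter fun i => g (σ i) i = b).image fun i => (i, σ i), ⟨?_, fun j => ?_⟩, ?_⟩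
    · intro x hx y hy hxy
      obtain ⟨i, _, rfl⟩ := Finset.mem_image.1 hx
      obtain ⟨i', _, rfl⟩ := Finset.mem_image.1 hy
      simp only at hxy
      rw [hxy]
    · refine le_of_eq_of_le ?_ (hb j b)
      rw [Finset.sum_filter, Finset.sum_image (fun i _ i' _ h => (Prod.mk.inj h).1),
        ← Finset.sum_filter, Finset.filter_filter, Finset.filter_filter]
      refine Finset.sum_congr (Finset.filter_congr fun i _ => ?_) fun _ _ => rfl
      constructor
      · rintro ⟨h, rfl⟩; exact ⟨rfl, h⟩
      · rintro ⟨rfl, h⟩; exact ⟨h, rfl⟩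
    · rw [items, Finset.image_image]
      exact Finset.image_id
  · have := Nat.floor_le (show 0 ≤ 2 * D by positivity)
    push_cast
    linarith

theorem Rounds.exists_load_le {I : GAP E m} {ε p : ℝ} {K : ℕ} {M : Fin m → ℝ}
    (hβ : 0 ≤ tau (ε ^ 2) / p) (hm : 0 < m) {n : ℕ} {Q : Finset E}
    (h : I.Rounds ε p K M n ∅ Q) :
    ∃ σ : E → Fin m, (∀ i ∈ Q, I.weight i (σ i) ≤ I.cap (σ i)) ∧
      ∀ j, ∑ i ∈ Q with σ i = j, I.weight i j ≤
        n * (K + 2) * (tau (ε ^ 2) / p + 1) * I.cap j := by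
  induction n generalizing Q with
  | zero =>
    obtain rfl : ∅ = Q := h
    exact ⟨fun _ => ⟨0, hm⟩, by simp, by simp⟩
  | succ n ih =>
    obtain ⟨Q₁, h₁, h₂⟩ := h
    obtain ⟨σ, hσ, hl⟩ := ih h₁
    obtain ⟨φ, hφ⟩ := h₂.spec (fun j => mul_nonneg hβ (I.cap_pos j).le) hm
    -- Each item keeps the knapsack through which it was queried.
    refine ⟨fun i => if i ∈ Q₁ then σ i else (φ i).1, fun i hi => ?_, fun j => ?_⟩
    · by_cases h : i ∈ Q₁
      · simpa only [if_pos h] using hσ i h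
      · simpa only [if_neg h] using hφ.weight_le i (Finset.mem_sdiff.2 ⟨hi, h⟩)
    · rw [Finset.sum_filter, ← Finset.sum_sdiff hφ.subset]
      have e1 : ∑ i ∈ Q \ Q₁, (if (if i ∈ Q₁ then σ i else (φ i).1) = j then I.weight i j else 0) =
          ∑ i ∈ Q \ Q₁ with (φ i).1 = j, I.weight i j := by
        rw [Finset.sum_filter]
        exact Finset.sum_congr rfl fun i hi => by rw [if_neg (Finset.mem_sdiff.1 hi).2]
      have e2 : ∑ i ∈ Q₁, (if (if i ∈ Q₁ then σ i else (φ i).1) = j then I.weight i j else 0) =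
          ∑ i ∈ Q₁ with σ i = j, I.weight i j := by
        rw [Finset.sum_filter]
        exact Finset.sum_congr rfl fun i hi => by rw [if_pos hi]
      rw [e1, e2]
      have h3 := hφ.load_le_total j
      have h4 := hl j
      push_cast
      linarith

end Degree

end GAP

/-! ### Replacing the items of one bucket. -/

section Replacement

variable {E : Type*}

/-- Any `|O|` elements of `N` will do: the weight of a lightest `o ∈ O` separates `N` from `O`, and
values differ by at most the factor `c`. -/
theorem exists_replacement_of_weight_le {w v : E → ℝ} {C a c : ℝ} (hC : 0 < C) (hc : 1 ≤ c)
    {O N : Finset E} (hw : ∀ i, 0 ≤ w i) (hO : ∑ i ∈ O, w i ≤ C) (hN : C ≤ ∑ i ∈ N, w i)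
    (hdom : ∀ n ∈ N, ∀ o ∈ O, w n ≤ w o) (hvN : ∀ n ∈ N, a ≤ v n) (hvO : ∀ o ∈ O, v o ≤ a * c) :
    ∃ S ⊆ N, ∑ i ∈ S, w i ≤ ∑ i ∈ O, w i ∧ (∑ i ∈ O, v i) / c ≤ ∑ i ∈ S, v i := by
  rcases O.eq_empty_or_nonempty with rfl | hne
  · exact ⟨∅, Finset.empty_subset _, by simp, by simp⟩
  obtain ⟨o, ho, hmin⟩ := O.exists_min_image w hne
  have hOcard : O.card * w o ≤ ∑ i ∈ O, w i := by
    rw [← nsmul_eq_mul]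
    exact Finset.card_nsmul_le_sum _ _ _ hmin
  have hle : ∀ S ⊆ N, ∑ i ∈ S, w i ≤ S.card * w o := by
    intro S hS
    rw [← nsmul_eq_mul]
    exact Finset.sum_le_card_nsmul _ _ _ fun n hn => hdom n (hS hn) o ho
  -- Otherwise `(|N| + 1) w o ≤ C ≤ |N| w o` forces `w o = 0`, and then `N` has weight `0 < C`.
  have hcard : O.card ≤ N.card := by
    by_contra! hlt
    have h1 : (N.card : ℝ) + 1 ≤ O.card := by exact_mod_cast hlt
    have h2 := hle N subset_rfl
    have h3 : 0 ≤ w o := hw o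
    have h4 : w o = 0 := by nlinarith
    rw [h4, mul_zero] at h2
    linarith
  obtain ⟨S, hS, hScard⟩ := Finset.exists_subset_card_eq hcard
  refine ⟨S, hS, ?_, ?_⟩
  · have := hle S hS
    rw [hScard] at this
    linarith
  · rw [div_le_iff₀ (by linarith)]
    have h1 : S.card • a ≤ ∑ i ∈ S, v i := Finset.card_nsmul_le_sum _ _ _ fun n hn => hvN n (hS hn)
    have h2 : ∑ i ∈ O, v i ≤ O.card • (a * c) := Finset.sum_le_card_nsmul _ _ _ hvO
    rw [hScard] at h1
    rw [nsmul_eq_mul] at h1 h2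
    nlinarith

/-- Take a subset of `N` of maximal cardinality within the weight of `O`. Either it is all of `N`,
or one more element overshoots that weight; at density at least `δ` the overshooting set is worth as
much as `O`, and the extra element is worth at most `μ`. -/
theorem exists_replacement_of_density_le [DecidableEq E] {w v : E → ℝ} {δ μ : ℝ} (hδ : 0 ≤ δ) (hμ : 0 ≤ μ)
    {O N : Finset E} (hw : ∀ i, 0 ≤ w i) (hON : ∑ i ∈ O, w i ≤ ∑ i ∈ N, w i)
    (hN : ∀ n ∈ N, δ * w n ≤ v n) (hO : ∀ o ∈ O, v o ≤ δ * w o) (hv : ∀ n ∈ N, v n ≤ μ) :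
    ∃ S ⊆ N, ∑ i ∈ S, w i ≤ ∑ i ∈ O, w i ∧ ∑ i ∈ O, v i - μ ≤ ∑ i ∈ S, v i := by
  obtain ⟨S, hS, hmax⟩ := (N.powerset.filter fun S => ∑ i ∈ S, w i ≤ ∑ i ∈ O, w i).exists_max_image
    Finset.card ⟨∅, by simpa using Finset.sum_nonneg fun i _ => hw i⟩
  simp only [Finset.mem_filter, Finset.mem_powerset] at hS hmax
  refine ⟨S, hS.1, hS.2, ?_⟩
  have hvO : ∑ i ∈ O, v i ≤ δ * ∑ i ∈ O, w i := by
    rw [Finset.mul_sum]; exact Finset.sum_le_sum hO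
  have hvS : δ * ∑ i ∈ S, w i ≤ ∑ i ∈ S, v i := by
    rw [Finset.mul_sum]; exact Finset.sum_le_sum fun i hi => hN i (hS.1 hi)
  by_cases h : N ⊆ S
  · obtain rfl := Finset.Subset.antisymm hS.1 h
    have := mul_le_mul_of_nonneg_left hON hδ
    linarith
  · obtain ⟨n, hn, hnS⟩ := Finset.not_subset.1 h
    have hlt : ∑ i ∈ O, w i < w n + ∑ i ∈ S, w i := by
      by_contra! hle
      have := hmax (insert n S) ⟨Finset.insert_subset hn hS.1, by rwa [Finset.sum_insert hnS]⟩
      rw [Finset.card_insert_of_notMem hnS] at this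
      omega
    have := mul_le_mul_of_nonneg_left hlt.le hδ
    have := hN n hn
    have := hv n hn
    linarith

end Replacement

namespace GAP

/-! ### Exchanging unqueried items of an optimal assignment for active queried ones. -/

section Exchange

variable {E : Type*} {m : ℕ}

/-- The threshold is the largest density in `O`. It is finite, although densities may be `∞`,
because it is bounded by the density of an element of `N` of positive weight. -/
theorem exists_density_threshold (I : GAP E m) (j : Fin m) {O N : Finset E}
    (hN : 0 < ∑ i ∈ N, I.weight i j)
    (hdom : ∀ n ∈ N, ∀ o ∈ O, I.density o j ≤ I.density n j) :
    ∃ δ : ℝ, 0 ≤ δ ∧ (∀ n ∈ N, δ * I.weight n j ≤ I.value n j) ∧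
      ∀ o ∈ O, I.value o j ≤ δ * I.weight o j := by
  have hsup : ∀ n ∈ N, (O.sup fun o => I.density o j) ≤ I.density n j := fun n hn =>
    Finset.sup_le fun o ho => hdom n hn o ho
  obtain ⟨n₀, hn₀, hw₀⟩ := Finset.exists_lt_of_sum_lt
    (s := N) (f := fun _ => (0 : ℝ)) (g := fun i => I.weight i j) (by simpa using hN)
  have hfin : (O.sup fun o => I.density o j) ≠ ⊤ := by
    refine ne_top_of_le_ne_top ?_ (hsup n₀ hn₀)
    exact ENNReal.div_ne_top ENNReal.ofReal_ne_top (by simpa using hw₀)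
  refine ⟨(O.sup fun o => I.density o j).toReal, ENNReal.toReal_nonneg, fun n hn => ?_,
    fun o ho => ?_⟩
  · rcases (I.weight_nonneg n j).eq_or_lt with h | h
    · rw [← h, mul_zero]
      exact I.value_nonneg n j
    · have h1 := hsup n hn
      rw [density, ENNReal.le_div_iff_mul_le (Or.inl (by simpa using h))
        (Or.inl ENNReal.ofReal_ne_top)] at h1
      have h2 := ENNReal.toReal_mono ENNReal.ofReal_ne_top h1
      rwa [ENNReal.toReal_mul, ENNReal.toReal_ofReal h.le,
        ENNReal.toReal_ofReal (I.value_nonneg n j)] at h2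
  · have h1 : I.density o j ≤ O.sup fun o => I.density o j :=
      Finset.le_sup (f := fun o => I.density o j) ho
    rw [density, ENNReal.div_le_iff_le_mul (Or.inr hfin) (Or.inl ENNReal.ofReal_ne_top)] at h1
    have h2 := ENNReal.toReal_mono (ENNReal.mul_ne_top hfin ENNReal.ofReal_ne_top) h1
    rwa [ENNReal.toReal_mul, ENNReal.toReal_ofReal (I.weight_nonneg o j),
        ENNReal.toReal_ofReal (I.value_nonneg o j)] at h2

theorem exists_bucket_replacement [DecidableEq E] {I : GAP E m} {ε : ℝ} {K : ℕ} {M : Fin m → ℝ}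
    {j : Fin m} {k : ℕ} (hM : 0 ≤ M j) {O N : Finset E}
    (hO : ∀ o ∈ O, I.InBucket ε K M o j k) (hk : O.Nonempty → k ≤ K)
    (hN : ∀ n ∈ N, I.InBucket ε K M n j k) (hdom : ∀ n ∈ N, ∀ o ∈ O, I.Dominates j k n o)
    (hOC : ∑ i ∈ O, I.weight i j ≤ I.cap j) (hNC : I.cap j ≤ ∑ i ∈ N, I.weight i j) :
    ∃ S ⊆ N, ∑ i ∈ S, I.weight i j ≤ ∑ i ∈ O, I.weight i j ∧
      (∑ i ∈ O, I.value i j) / (1 + ε ^ 2) - (if k = 0 then ε ^ 2 * M j else 0) ≤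
        ∑ i ∈ S, I.value i j := by
  have hb : 0 ≤ ε ^ 2 * M j := by positivity
  rcases O.eq_empty_or_nonempty with rfl | hne
  · refine ⟨∅, Finset.empty_subset _, by simp, ?_⟩
    simp only [Finset.sum_empty, zero_div, zero_sub]
    split_ifs <;> linarith
  have hkK := hk hne
  have hO0 : 0 ≤ ∑ i ∈ O, I.value i j := Finset.sum_nonneg fun i _ => I.value_nonneg i j
  rcases Nat.eq_zero_or_pos k with rfl | hk1
  · obtain ⟨δ, hδ, hNδ, hOδ⟩ := I.exists_density_threshold j ((I.cap_pos j).trans_le hNC)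
      fun n hn o ho => (hdom n hn o ho).2 rfl
    obtain ⟨S, hS, hSw, hSv⟩ := exists_replacement_of_density_le hδ hb
      (fun i => I.weight_nonneg i j) (hOC.trans hNC) hNδ hOδ fun n hn => by
        rcases hN n hn with h | h | h
        · exact h.2
        · omega
        · omega
    refine ⟨S, hS, hSw, ?_⟩
    -- In bucket `0` the factor is not needed; it only makes the two cases uniform.
    have : (∑ i ∈ O, I.value i j) / (1 + ε ^ 2) ≤ ∑ i ∈ O, I.value i j :=
      div_le_self hO0 (by nlinarith)
    rw [if_pos rfl]
    linarith
  · obtain ⟨S, hS, hSw, hSv⟩ := exists_replacement_of_weight_le (w := fun i => I.weight i j)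
      (v := fun i => I.value i j) (a := ε ^ 2 * (1 + ε ^ 2) ^ (k - 1) * M j) (c := 1 + ε ^ 2)
      (I.cap_pos j) (by nlinarith) (fun i => I.weight_nonneg i j) hOC hNC
      (fun n hn o ho => (hdom n hn o ho).1 hk1)
      (fun n hn => by
        rcases hN n hn with h | h | h
        · omega
        · exact h.2.2.1.le
        · omega)
      (fun o ho => by
        rcases hO o ho with h | h | h
        · omega
        · refine h.2.2.2.trans_eq ?_
          obtain ⟨k', rfl⟩ := Nat.exists_eq_add_of_le' hk1
          simp only [Nat.add_sub_cancel]
          ring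
        · omega)
    refine ⟨S, hS, hSw, ?_⟩
    rw [if_neg (by omega), sub_zero]
    exact hSv

theorem exists_inBucket (I : GAP E m) (ε : ℝ) (K : ℕ) (M : Fin m → ℝ) (i : E) (j : Fin m) :
    ∃ k, I.InBucket ε K M i j k := by
  classical
  -- The least such `k` is the bucket, truncated at `K + 1`; minimality replaces monotonicity of the
  -- thresholds, so `M j` may have any sign.
  by_cases h : ∃ k, I.value i j ≤ ε ^ 2 * (1 + ε ^ 2) ^ k * M j
  · have hs := Nat.find_spec h
    have hmin := fun k (hk : k < Nat.find h) => Nat.find_min h hk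
    set k := Nat.find h
    rcases Nat.eq_zero_or_pos k with h0 | h1
    · exact ⟨0, Or.inl ⟨rfl, by simpa [h0] using hs⟩⟩
    · by_cases hK : k ≤ K
      · exact ⟨k, Or.inr (Or.inl ⟨h1, hK, not_le.1 (hmin (k - 1) (by omega)), hs⟩)⟩
      · exact ⟨K + 1, Or.inr (Or.inr ⟨rfl, not_le.1 (hmin K (by omega))⟩)⟩
  · exact ⟨K + 1, Or.inr (Or.inr ⟨rfl, not_le.1 (not_exists.1 h K)⟩)⟩

variable [Fintype E] [DecidableEq E]

/-- The items outside `Q` that `A` assigns to `j` and that belong to bucket `k` according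
to `κ`. -/
def bucketRest (A : Finset (E × Fin m)) (Q : Finset E) (κ : E → Fin m → ℕ) (j : Fin m) (k : ℕ) :
    Finset E :=
  Finset.univ.filter fun i => ((i, j) ∈ A ∧ i ∉ Q) ∧ κ i j = k

theorem sum_bucketRest (A : Finset (E × Fin m)) (Q : Finset E) {κ : E → Fin m → ℕ} {n : ℕ}
    (hκ : ∀ i j, κ i j < n) (j : Fin m) (f : E → ℝ) :
    ∑ k ∈ Finset.range n, ∑ i ∈ bucketRest A Q κ j k, f i =
      ∑ x ∈ A with x.1 ∉ Q ∧ x.2 = j, f x.1 := by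
  have h1 : ∀ k ∈ Finset.range n, ∑ i ∈ bucketRest A Q κ j k, f i =
      ∑ i ∈ (Finset.univ.filter fun i => (i, j) ∈ A ∧ i ∉ Q) with κ i j = k, f i := by
    intro k _
    rw [Finset.filter_filter]
    rfl
  rw [Finset.sum_congr rfl h1, Finset.sum_fiberwise_of_maps_to
    (fun i _ => Finset.mem_range.2 (hκ i j))]
  refine Finset.sum_nbij' (fun i => (i, j)) Prod.fst ?_ ?_ ?_ ?_ ?_
  · intro i hi
    simpa using hi
  · rintro ⟨i, j'⟩ hx
    simp only [Finset.mem_filter] at hx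
    obtain ⟨h, h', rfl⟩ := hx
    simpa using ⟨h, h'⟩
  · simp
  · rintro ⟨i, j'⟩ hx
    simp only [Finset.mem_filter] at hx
    simp [hx.2.2]
  · simp

theorem sum_sum_bucketRest (A : Finset (E × Fin m)) (Q : Finset E) {κ : E → Fin m → ℕ} {n : ℕ}
    (hκ : ∀ i j, κ i j < n) (f : E → Fin m → ℝ) :
    ∑ j, ∑ k ∈ Finset.range n, ∑ i ∈ bucketRest A Q κ j k, f i j =
      ∑ x ∈ A with x.1 ∉ Q, f x.1 x.2 := by
  rw [← Finset.sum_fiberwise (g := Prod.snd)]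
  refine Finset.sum_congr rfl fun j _ => ?_
  rw [sum_bucketRest A Q hκ j fun i => f i j, Finset.filter_filter]
  refine Finset.sum_congr rfl fun x hx => ?_
  rw [(Finset.mem_filter.1 hx).2.2]

/-- Keep the pairs of an optimal assignment whose items lie in `Q`, and replace those outside `Q'`
by active items of the round from `Q` to `Q'`. -/
theorem RoundSpec.le_bestValue {I : GAP E m} {ε : ℝ} {K : ℕ} {M : Fin m → ℝ} {β : Fin m → ℝ}
    {Q Q' : Finset E} {φ : E → Fin m × ℕ} (h : I.RoundSpec ε K M β Q Q' φ) (hM : ∀ j, 0 ≤ M j)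
    {κ : E → Fin m → ℕ} (hκ : ∀ i j, I.InBucket ε K M i j (κ i j))
    (hsuper : ∀ i ∉ Q', ∀ j, I.weight i j ≤ I.cap j → κ i j ≤ K)
    {O : Finset (E × Fin m)} (hO : I.IsValid O) {A B : Finset E} (hOA : items O ⊆ A) :
    ∑ x ∈ O with x.1 ∈ Q, I.value x.1 x.2 +
      ∑ j, ∑ k ∈ Finset.range (K + 2),
        ((if I.cap j ≤ ∑ i ∈ B ∩ bucketPart φ (Q' \ Q) j k, I.weight i j then (1 : ℝ) else 0) *
          ((∑ i ∈ bucketRest O Q' κ j k, I.value i j) / (1 + ε ^ 2))) - ∑ j, ε ^ 2 * M j ≤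
      I.bestValue (Q' ∩ (A \ (Q' \ Q) ∪ B ∩ (Q' \ Q))) := by
  have hκn : ∀ i j, κ i j < K + 2 := fun i j => by
    have := (hκ i j).le
    omega
  have hwO : ∀ x ∈ O, I.weight x.1 x.2 ≤ I.cap x.2 := fun x hx =>
    (Finset.single_le_sum (f := fun y => I.weight y.1 x.2) (fun y _ => I.weight_nonneg y.1 x.2)
      (show x ∈ O.filter fun y => y.2 = x.2 from Finset.mem_filter.2 ⟨hx, rfl⟩)).trans (hO.2 x.2)
  have hrestC : ∀ j, ∑ x ∈ O with x.1 ∈ Q ∧ x.2 = j, I.weight x.1 j +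
      ∑ k ∈ Finset.range (K + 2), ∑ i ∈ bucketRest O Q' κ j k, I.weight i j ≤ I.cap j := by
    intro j
    rw [sum_bucketRest O Q' hκn j fun i => I.weight i j, ← Finset.sum_union]
    · refine (Finset.sum_le_sum_of_subset_of_nonneg ?_ fun x _ _ => I.weight_nonneg x.1 j).trans
        (hO.2 j)
      intro x hx
      simp only [Finset.mem_union, Finset.mem_filter] at hx ⊢
      tauto
    · rw [Finset.disjoint_left]
      intro x hx hx'
      simp only [Finset.mem_filter] at hx hx'
      exact hx'.2.1 (h.subset hx.2.1)
  -- If the active part of the bucket is too light, the indicator vanishes and `S = ∅` suffices.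
  have hS : ∀ j k, ∃ S ⊆ B ∩ bucketPart φ (Q' \ Q) j k,
      ∑ i ∈ S, I.weight i j ≤ ∑ i ∈ bucketRest O Q' κ j k, I.weight i j ∧
      (if I.cap j ≤ ∑ i ∈ B ∩ bucketPart φ (Q' \ Q) j k, I.weight i j then (1 : ℝ) else 0) *
        ((∑ i ∈ bucketRest O Q' κ j k, I.value i j) / (1 + ε ^ 2)) -
        (if k = 0 then ε ^ 2 * M j else 0) ≤ ∑ i ∈ S, I.value i j := by
    intro j k
    have hb : 0 ≤ ε ^ 2 * M j := mul_nonneg (sq_nonneg _) (hM j)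
    have hrest : ∀ i ∈ bucketRest O Q' κ j k, i ∉ Q' ∧ I.InBucket ε K M i j k ∧
        I.weight i j ≤ I.cap j ∧ κ i j = k := by
      intro i hi
      obtain ⟨⟨hiO, hiQ⟩, rfl⟩ := (Finset.mem_filter.1 hi).2
      exact ⟨hiQ, hκ i j, hwO (i, j) hiO, rfl⟩
    by_cases hgood : I.cap j ≤ ∑ i ∈ B ∩ bucketPart φ (Q' \ Q) j k, I.weight i j
    · rw [if_pos hgood, one_mul]
      refine exists_bucket_replacement (hM j) (fun i hi => (hrest i hi).2.1) ?_ ?_ ?_ ?_ hgood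
      · rintro ⟨i, hi⟩
        obtain ⟨h1, _, h2, rfl⟩ := hrest i hi
        exact hsuper i h1 j h2
      · intro n hn
        obtain ⟨hn1, hn2⟩ := Finset.mem_filter.1 (Finset.mem_inter.1 hn).2
        have := h.inBucket n hn1
        rwa [hn2] at this
      · intro n hn o ho
        obtain ⟨h1, h2, h3, _⟩ := hrest o ho
        exact h.dominates j k o h1 h2 h3 n (Finset.mem_inter.1 hn).2
      · by_cases hk : k ∈ Finset.range (K + 2)
        · have h1 := Finset.single_le_sum
            (f := fun k => ∑ i ∈ bucketRest O Q' κ j k, I.weight i j)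
            (fun k _ => Finset.sum_nonneg fun i _ => I.weight_nonneg i j) hk
          have h2 := hrestC j
          have h3 : 0 ≤ ∑ x ∈ O with x.1 ∈ Q ∧ x.2 = j, I.weight x.1 j :=
            Finset.sum_nonneg fun x _ => I.weight_nonneg x.1 j
          linarith
        · rw [Finset.sum_eq_zero]
          · exact (I.cap_pos j).le
          · intro i hi
            exact absurd (Finset.mem_range.2 ((hrest i hi).2.2.2 ▸ hκn i j)) hk
    · refine ⟨∅, Finset.empty_subset _, ?_, ?_⟩
      · exact Finset.sum_nonneg fun i _ => I.weight_nonneg i j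
      · rw [if_neg hgood]
        simp only [zero_mul, zero_sub, Finset.sum_empty]
        split_ifs <;> linarith
  choose S hSsub hSw hSv using hS
  have hSφ : ∀ j k, ∀ i ∈ S j k, i ∈ B ∧ i ∈ Q' \ Q ∧ φ i = (j, k) := by
    intro j k i hi
    have h1 := Finset.mem_inter.1 (hSsub j k hi)
    exact ⟨h1.1, Finset.mem_filter.1 h1.2⟩
  -- The union of all `S j k`; it is disjoint because `φ` names a single bucket for each item.
  let U : Finset E := (Q' \ Q).filter fun i => i ∈ S (φ i).1 (φ i).2
  have hUS : ∀ j k, U.filter (fun i => φ i = (j, k)) = S j k := by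
    intro j k
    ext i
    simp only [U, Finset.mem_filter]
    constructor
    · rintro ⟨⟨_, h1⟩, h2⟩
      rwa [h2] at h1
    · intro hi
      obtain ⟨_, h1, h2⟩ := hSφ j k i hi
      exact ⟨⟨h1, by rwa [h2]⟩, h2⟩
  have hUj : ∀ (j : Fin m) (f : E → ℝ), ∑ i ∈ U with (φ i).1 = j, f i =
      ∑ k ∈ Finset.range (K + 2), ∑ i ∈ S j k, f i := by
    intro j f
    rw [← Finset.sum_fiberwise_of_maps_to (t := Finset.range (K + 2)) (g := fun i => (φ i).2)]
    · refine Finset.sum_congr rfl fun k _ => ?_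
      rw [Finset.filter_filter, ← hUS j k]
      refine Finset.sum_congr (Finset.filter_congr fun i _ => ?_) fun _ _ => rfl
      rw [Prod.ext_iff]
    · intro i hi
      have h1 := (Finset.mem_filter.1 (Finset.mem_filter.1 hi).1).1
      have h2 := (h.inBucket i h1).le
      exact Finset.mem_range.2 (by omega)
  let T : Finset (E × Fin m) := O.filter (fun x => x.1 ∈ Q) ∪ U.image fun i => (i, (φ i).1)
  have hTQ : ∀ i ∈ U, i ∉ Q := fun i hi =>
    (Finset.mem_sdiff.1 (Finset.mem_filter.1 hi).1).2
  have hdisj : Disjoint (O.filter fun x => x.1 ∈ Q) (U.image fun i => (i, (φ i).1)) := by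
    rw [Finset.disjoint_left]
    intro x hx hx'
    obtain ⟨i, hi, rfl⟩ := Finset.mem_image.1 hx'
    exact hTQ i hi (Finset.mem_filter.1 hx).2
  have hinj : Set.InjOn (fun i => (i, (φ i).1)) (U : Set E) := fun i _ i' _ h =>
    (Prod.mk.inj h).1
  have hTvalid : I.IsValid T := by
    refine ⟨fun x hx y hy hxy => ?_, fun j => ?_⟩
    · rcases Finset.mem_union.1 hx with hx | hx <;> rcases Finset.mem_union.1 hy with hy | hy
      · exact hO.1 x (Finset.mem_filter.1 hx).1 y (Finset.mem_filter.1 hy).1 hxy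
      · obtain ⟨i, hi, rfl⟩ := Finset.mem_image.1 hy
        have h1 := (Finset.mem_filter.1 hx).2
        rw [hxy] at h1
        exact absurd h1 (hTQ i hi)
      · obtain ⟨i, hi, rfl⟩ := Finset.mem_image.1 hx
        have h1 := (Finset.mem_filter.1 hy).2
        rw [← hxy] at h1
        exact absurd h1 (hTQ i hi)
      · obtain ⟨i, _, rfl⟩ := Finset.mem_image.1 hx
        obtain ⟨i', _, rfl⟩ := Finset.mem_image.1 hy
        simp only at hxy
        rw [hxy]
    · rw [Finset.sum_filter, Finset.sum_union hdisj, Finset.sum_image hinj, ← Finset.sum_filter,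
        ← Finset.sum_filter, Finset.filter_filter, hUj]
      refine le_trans ?_ (hrestC j)
      exact add_le_add le_rfl (Finset.sum_le_sum fun k _ => hSw j k)
  -- Kept items lie in `Q`, hence outside the resampled set and active through `A`; replacements lie
  -- inside it and are active through `B`.
  have hTitems : items T ⊆ Q' ∩ (A \ (Q' \ Q) ∪ B ∩ (Q' \ Q)) := by
    intro i hi
    obtain ⟨x, hx, rfl⟩ := Finset.mem_image.1 hi
    rcases Finset.mem_union.1 hx with hx | hx
    · obtain ⟨h1, h2⟩ := Finset.mem_filter.1 hx
      have h3 : x.1 ∈ A := hOA (Finset.mem_image_of_mem _ h1)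
      have h4 := h.subset h2
      simp only [Finset.mem_inter, Finset.mem_union, Finset.mem_sdiff]
      tauto
    · obtain ⟨i, hiU, rfl⟩ := Finset.mem_image.1 hx
      obtain ⟨h1, h2⟩ := Finset.mem_filter.1 hiU
      have h3 := (hSφ _ _ i h2).1
      have h4 := (Finset.mem_sdiff.1 h1).1
      simp only [Finset.mem_inter, Finset.mem_union]
      exact ⟨h4, Or.inr ⟨h3, h1⟩⟩
  refine le_trans ?_ (totalValue_le_bestValue hTvalid hTitems)
  have hTv : I.totalValue T = ∑ x ∈ O with x.1 ∈ Q, I.value x.1 x.2 +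
      ∑ j, ∑ k ∈ Finset.range (K + 2), ∑ i ∈ S j k, I.value i j := by
    rw [totalValue, Finset.sum_union hdisj, Finset.sum_image hinj,
      ← Finset.sum_fiberwise (g := fun i => (φ i).1)]
    congr 1
    refine Finset.sum_congr rfl fun j _ => ?_
    rw [← hUj j fun i => I.value i j]
    exact Finset.sum_congr rfl fun i hi => by rw [(Finset.mem_filter.1 hi).2]
  have hb : ∑ j, ε ^ 2 * M j =
      ∑ j, ∑ k ∈ Finset.range (K + 2), (if k = 0 then ε ^ 2 * M j else 0) := by
    refine Finset.sum_congr rfl fun j _ => ?_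
    rw [Finset.sum_ite_eq' (Finset.range (K + 2)) 0 fun _ => ε ^ 2 * M j]
    simp
  rw [hTv, hb, add_sub_assoc, ← Finset.sum_sub_distrib]
  gcongr with j _
  rw [← Finset.sum_sub_distrib]
  exact Finset.sum_le_sum fun k _ => hSv j k

end Exchange

end GAP

namespace GAP

/-! ### The approximation ratio and the numerical degree bound. -/

section Guarantee

/-- The reason for the choice of `K`: since `log (1 + ε²) ≥ ε² / 2`, every value in a super bucket
exceeds `m M_j / ε`, which is the expected optimum divided by `ε`. -/
theorem le_scale {ε : ℝ} (h0 : 0 < ε) (h1 : ε < 1 / 6) {m K : ℕ} (hm : 0 < m)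
    (hK : K = ⌈2 / ε ^ 2 * Real.log (m / ε ^ 3)⌉₊) : m / ε ≤ ε ^ 2 * (1 + ε ^ 2) ^ K := by
  have hm' : (1 : ℝ) ≤ m := by exact_mod_cast hm
  have h2 : ε ^ 2 / 2 ≤ Real.log (1 + ε ^ 2) := by
    refine le_trans ?_ (Real.le_log_one_add_of_nonneg (sq_nonneg ε))
    rw [div_le_div_iff₀ (by norm_num) (by positivity)]
    nlinarith [pow_pos h0 2, pow_le_one₀ h0.le (by linarith : ε ≤ 1) (n := 2)]
  have h3 : Real.log (m / ε ^ 3) ≤ K * Real.log (1 + ε ^ 2) := by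
    have h4 : 2 / ε ^ 2 * Real.log (m / ε ^ 3) ≤ K := hK ▸ Nat.le_ceil _
    calc Real.log (m / ε ^ 3) = 2 / ε ^ 2 * Real.log (m / ε ^ 3) * (ε ^ 2 / 2) := by field_simp
      _ ≤ K * Real.log (1 + ε ^ 2) := by gcongr
  rw [← Real.log_pow, Real.log_le_log_iff (by positivity) (by positivity)] at h3
  calc (m : ℝ) / ε = ε ^ 2 * (m / ε ^ 3) := by field_simp
    _ ≤ _ := by gcongr

theorem exists_chain {E : Type*} [DecidableEq E] {m : ℕ} {I : GAP E m} {ε p : ℝ} {K : ℕ} {M : Fin m → ℝ} {n : ℕ} {Q Q' : Finset E}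
    (h : I.Rounds ε p K M n Q Q') :
    ∃ q : ℕ → Finset E, q 0 = Q ∧ q n = Q' ∧ ∀ t < n, I.Round ε p K M (q t) (q (t + 1)) := by
  induction n generalizing Q' with
  | zero => exact ⟨fun _ => Q, rfl, h, by simp⟩
  | succ n ih =>
    obtain ⟨Q₁, h₁, h₂⟩ := h
    obtain ⟨q, hq0, hqn, hq⟩ := ih h₁
    refine ⟨fun t => if t ≤ n then q t else Q', by simpa using hq0, by simp, fun t ht => ?_⟩
    rcases Nat.lt_succ_iff_lt_or_eq.1 ht with h | rfl
    · simpa only [if_pos h.le, if_pos (Nat.succ_le_of_lt h)] using hq t h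
    · simpa [hqn] using h₂

variable {E : Type*} [Fintype E] [DecidableEq E] {m : ℕ}

open PackingProblem

theorem expectedOpt_nonneg (I : GAP E m) {p : ℝ} (hp0 : 0 ≤ p) (hp1 : p ≤ 1) :
    0 ≤ I.toPacking.expectedOpt p :=
  expect_nonneg hp0 hp1 fun R => I.opt_nonneg R

theorem le_opt_of_mem (I : GAP E m) {i : E} {j : Fin m} (hw : I.weight i j ≤ I.cap j)
    {R : Finset E} (hi : i ∈ R) : I.value i j ≤ I.toPacking.opt R := by
  have hA : I.IsValid {(i, j)} := by
    refine ⟨by simp, fun j' => ?_⟩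
    by_cases h : j = j'
    · subst h; simpa [Finset.filter_singleton] using hw
    · simpa [Finset.filter_singleton, h] using (I.cap_pos j').le
  have h := totalValue_le_bestValue (S := R) hA (by simpa [items] using hi)
  rw [opt_toPacking]
  simpa [totalValue] using h

theorem RoundSpec.expect_full_ge {I : GAP E m} {ε p : ℝ} {K : ℕ} {M : Fin m → ℝ} {Q Q' : Finset E}
    {φ : E → Fin m × ℕ} (h0 : 0 < ε) (h1 : ε < 1 / 6) (hp0 : 0 < p) (hp1 : p ≤ 1)
    (h : I.RoundSpec ε K M (fun j => tau (ε ^ 2) / p * I.cap j) Q Q' φ) {i : E} (hi : i ∉ Q')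
    {j : Fin m} {k : ℕ} (hb : I.InBucket ε K M i j k) (hw : I.weight i j ≤ I.cap j) :
    1 - ε ^ 2 ≤ expect p fun R =>
      if I.cap j ≤ ∑ i ∈ R ∩ bucketPart φ (Q' \ Q) j k, I.weight i j then 1 else 0 :=
  expect_indicator_ge h0 h1 hp0 hp1 (I.cap_pos j) _ _ (fun n _ => I.weight_nonneg n j)
    (fun n hn => by
      obtain ⟨h1, h2⟩ := Finset.mem_filter.1 hn
      have := h.weight_le n h1
      rwa [h2] at this) (h.le_load j k i hi hb hw)

/-- The super buckets are never exhausted. -/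
theorem RoundSpec.not_inBucket_super {I : GAP E m} {ε p : ℝ} {K : ℕ} {M : Fin m → ℝ}
    {Q Q' : Finset E} {φ : E → Fin m × ℕ} (h0 : 0 < ε) (h1 : ε < 1 / 6) (hp0 : 0 < p) (hp1 : p ≤ 1)
    (hm : 0 < m) (hM : ∀ j, M j = I.toPacking.expectedOpt p / m)
    (hK : K = ⌈2 / ε ^ 2 * Real.log (m / ε ^ 3)⌉₊) (hpos : 0 < I.toPacking.expectedOpt p)
    (h : I.RoundSpec ε K M (fun j => tau (ε ^ 2) / p * I.cap j) Q Q' φ) {i : E} (hi : i ∉ Q')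
    {j : Fin m} (hw : I.weight i j ≤ I.cap j) : ¬ I.InBucket ε K M i j (K + 1) := by
  intro hb
  have hprob := h.expect_full_ge h0 h1 hp0 hp1 hi hb hw
  set Z := I.toPacking.expectedOpt p with hZ
  have hm' : (0 : ℝ) < m := by exact_mod_cast hm
  have hlarge : ∀ n, I.InBucket ε K M n j (K + 1) → Z / ε ≤ I.value n j := by
    intro n hn
    rcases hn with hn | hn | hn
    · omega
    · omega
    · refine le_trans ?_ hn.2.le
      rw [hM j]
      calc Z / ε = m / ε * (Z / m) := by field_simp
        _ ≤ _ := by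
          gcongr
          exact le_scale h0 h1 hm hK
  -- An active part of weight at least `C_j > 0` is nonempty, and any one of its items alone is
  -- worth `Z / ε`.
  have hpt : ∀ R : Finset E, Z / ε *
      (if I.cap j ≤ ∑ i ∈ R ∩ bucketPart φ (Q' \ Q) j (K + 1), I.weight i j then (1 : ℝ) else 0) ≤
      I.toPacking.opt R := by
    intro R
    split_ifs with hR
    · obtain ⟨n, hn, -⟩ := Finset.exists_lt_of_sum_lt
        (s := R ∩ bucketPart φ (Q' \ Q) j (K + 1)) (f := fun _ => (0 : ℝ))
        (g := fun i => I.weight i j) (by simpa using (I.cap_pos j).trans_le hR)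
      obtain ⟨hnR, hn⟩ := Finset.mem_inter.1 hn
      obtain ⟨hn1, hn2⟩ := Finset.mem_filter.1 hn
      have hnb := h.inBucket n hn1
      have hnw := h.weight_le n hn1
      rw [hn2] at hnb hnw
      rw [mul_one]
      exact (hlarge n hnb).trans (I.le_opt_of_mem hnw hnR)
    · rw [mul_zero]
      exact I.opt_nonneg R
  have hexp := expect_mono hp0.le hp1 hpt
  rw [expect_mul_left] at hexp
  change _ ≤ Z at hexp
  have h2 : Z / ε * (1 - ε ^ 2) ≤ Z := (mul_le_mul_of_nonneg_left hprob (by positivity)).trans hexp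
  -- Probability at least `1 / 2` of an optimum above `6 Z` contradicts the mean `Z`.
  have h3 : 6 * Z < Z / ε := by rw [lt_div_iff₀ h0]; nlinarith
  have h4 : (1 : ℝ) / 2 ≤ 1 - ε ^ 2 := by nlinarith
  have h5 : Z / ε * (1 / 2) ≤ Z / ε * (1 - ε ^ 2) := by gcongr
  linarith

/-- The guarantee of a single round, in terms of an optimal assignment `O R` for each active
set `R`. -/
theorem RoundSpec.expect_opt_ge {I : GAP E m} {ε p : ℝ} {K : ℕ} {M : Fin m → ℝ}
    {Q Q' : Finset E} {φ : E → Fin m × ℕ} (h0 : 0 < ε) (h1 : ε < 1 / 6) (hp0 : 0 < p) (hp1 : p ≤ 1)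
    (hm : 0 < m) (hM : ∀ j, M j = I.toPacking.expectedOpt p / m)
    (hK : K = ⌈2 / ε ^ 2 * Real.log (m / ε ^ 3)⌉₊) (hpos : 0 < I.toPacking.expectedOpt p)
    (h : I.RoundSpec ε K M (fun j => tau (ε ^ 2) / p * I.cap j) Q Q' φ)
    {O : Finset E → Finset (E × Fin m)} (hO : ∀ R, I.IsValid (O R)) (hOR : ∀ R, items (O R) ⊆ R) :
    expect p (fun R => ∑ x ∈ O R with x.1 ∈ Q, I.value x.1 x.2) +
      (1 - ε ^ 2) / (1 + ε ^ 2) * expect p (fun R => ∑ x ∈ O R with x.1 ∉ Q', I.value x.1 x.2) -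
      ε ^ 2 * I.toPacking.expectedOpt p ≤ expect p fun R => I.toPacking.opt (Q' ∩ R) := by
  have hm' : (0 : ℝ) < m := by exact_mod_cast hm
  choose κ hκ using fun i j => I.exists_inBucket ε K M i j
  have hκn : ∀ i j, κ i j < K + 2 := fun i j => by
    have := (hκ i j).le
    omega
  have hM0 : ∀ j, 0 ≤ M j := fun j => by rw [hM j]; positivity
  have hsuper : ∀ i ∉ Q', ∀ j, I.weight i j ≤ I.cap j → κ i j ≤ K := by
    intro i hi j hw
    by_contra! hlt
    have hb := hκ i j
    have : κ i j = K + 1 := by have := hb.le; omega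
    rw [this] at hb
    exact h.not_inBucket_super h0 h1 hp0 hp1 hm hM hK hpos hi hw hb
  have hMsum : ∑ j, ε ^ 2 * M j = ε ^ 2 * I.toPacking.expectedOpt p := by
    simp only [hM, Finset.sum_const, Finset.card_univ, Fintype.card_fin, nsmul_eq_mul]
    field_simp
  -- The outer copy `A` determines the assignment `O A`; the inner copy `B`, independent of it,
  -- decides which buckets have a heavy active part.
  rw [expect_resample p (Q' \ Q) fun R => I.toPacking.opt (Q' ∩ R)]
  have hpt : ∀ A : Finset E, ∑ x ∈ O A with x.1 ∈ Q, I.value x.1 x.2 +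
      (1 - ε ^ 2) / (1 + ε ^ 2) * (∑ x ∈ O A with x.1 ∉ Q', I.value x.1 x.2) -
      ε ^ 2 * I.toPacking.expectedOpt p ≤
      expect p fun B => I.toPacking.opt (Q' ∩ (A \ (Q' \ Q) ∪ B ∩ (Q' \ Q))) := by
    intro A
    have hB := expect_mono hp0.le hp1 fun B => (h.le_bestValue hM0 hκ hsuper (hO A) (B := B) (hOR A))
    simp only [expect_sub, expect_add, expect_const, expect_sum] at hB
    simp only [opt_toPacking]
    refine le_trans ?_ hB
    rw [hMsum]
    gcongr
    rw [← sum_sum_bucketRest (O A) Q' hκn, Finset.mul_sum]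
    refine Finset.sum_le_sum fun j _ => ?_
    rw [Finset.mul_sum]
    refine Finset.sum_le_sum fun k _ => ?_
    simp only [mul_comm _ ((∑ i ∈ bucketRest (O A) Q' κ j k, I.value i j) / (1 + ε ^ 2))]
    rw [expect_mul_left]
    -- A bucket is known to be full only if an eligible item was left unqueried; when there is
    -- nothing to replace, no bound is needed.
    rcases (bucketRest (O A) Q' κ j k).eq_empty_or_nonempty with he | ⟨i, hi⟩
    · simp [he]
    · obtain ⟨⟨hiO, hiQ⟩, rfl⟩ := (Finset.mem_filter.1 hi).2
      have hw : I.weight i j ≤ I.cap j :=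
        (Finset.single_le_sum (f := fun y => I.weight y.1 j) (fun y _ => I.weight_nonneg y.1 j)
          (show (i, j) ∈ (O A).filter fun y => y.2 = j from
            Finset.mem_filter.2 ⟨hiO, rfl⟩)).trans ((hO A).2 j)
      have hprob := h.expect_full_ge h0 h1 hp0 hp1 hiQ (hκ i j) hw
      have h2 : 0 ≤ (∑ i' ∈ bucketRest (O A) Q' κ j (κ i j), I.value i' j) / (1 + ε ^ 2) :=
        div_nonneg (Finset.sum_nonneg fun i' _ => I.value_nonneg i' j) (by positivity)
      refine le_of_eq_of_le ?_ (mul_le_mul_of_nonneg_left hprob h2)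
      ring
  have hfin := expect_mono hp0.le hp1 hpt
  rwa [expect_sub, expect_add, expect_mul_left, expect_const] at hfin

theorem IsOutput.expect_opt_ge {I : GAP E m} {ε p : ℝ} {K : ℕ} {M : Fin m → ℝ} {Q : Finset E}
    (h0 : 0 < ε) (h1 : ε < 1 / 6) (hp0 : 0 < p) (hp1 : p ≤ 1) (hm : 0 < m)
    (hM : ∀ j, M j = I.toPacking.expectedOpt p / m)
    (hK : K = ⌈2 / ε ^ 2 * Real.log (m / ε ^ 3)⌉₊) (h : I.IsOutput ε p K M Q) :
    (1 - 6 * ε) * I.toPacking.expectedOpt p ≤ expect p fun R => I.toPacking.opt (Q ∩ R) := by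
  -- The super bucket argument needs a positive expected optimum.
  rcases (I.expectedOpt_nonneg hp0.le hp1).eq_or_lt with hz | hpos
  · rw [← hz, mul_zero]
    exact expect_nonneg hp0.le hp1 fun R => I.opt_nonneg _
  have hε2 : ε ^ 2 ≤ 1 := pow_le_one₀ h0.le (by linarith)
  have hτ : 0 ≤ tau (ε ^ 2) / p := div_nonneg (tau_nonneg (by positivity) hε2) hp0.le
  obtain ⟨q, hq0, hqT, hq⟩ := exists_chain h
  set T := ⌈1 / ε⌉₊ - 1 with hT
  have hspec : ∀ t < T, ∃ φ, I.RoundSpec ε K M (fun j => tau (ε ^ 2) / p * I.cap j)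
      (q t) (q (t + 1)) φ := fun t ht =>
    (hq t ht).spec (fun j => mul_nonneg hτ (I.cap_pos j).le) hm
  choose O hO hOR hOv using fun R => I.exists_bestValue R
  set Z := I.toPacking.expectedOpt p with hZ
  let F : ℕ → ℝ := fun t => expect p fun R => ∑ x ∈ O R with x.1 ∈ q t, I.value x.1 x.2
  have hFZ : ∀ t, F t + expect p (fun R => ∑ x ∈ O R with x.1 ∉ q t, I.value x.1 x.2) = Z := by
    intro t
    rw [← expect_add]
    refine congrArg (expect p) (funext fun R => ?_)
    rw [Finset.sum_filter_add_sum_filter_not, opt_toPacking, ← hOv R]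
    rfl
  have hrest0 : ∀ t, 0 ≤ expect p (fun R => ∑ x ∈ O R with x.1 ∉ q t, I.value x.1 x.2) :=
    fun t => expect_nonneg hp0.le hp1 fun R => Finset.sum_nonneg fun x _ => I.value_nonneg _ _
  have hF0 : ∀ t, 0 ≤ F t :=
    fun t => expect_nonneg hp0.le hp1 fun R => Finset.sum_nonneg fun x _ => I.value_nonneg _ _
  have hTge : 1 / ε - 1 ≤ T := by
    have h2 : 1 / ε ≤ ⌈1 / ε⌉₊ := Nat.le_ceil _
    have h3 : 1 ≤ ⌈1 / ε⌉₊ := Nat.one_le_ceil_iff.2 (by positivity)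
    rw [hT, Nat.cast_sub h3]
    push_cast
    linarith
  have h6 : 6 < 1 / ε := by rw [lt_div_iff₀ h0]; linarith
  have hTpos : 0 < (T : ℝ) := by linarith
  -- Pigeonhole over the telescoping sum `F T - F 0 ≤ Z`.
  obtain ⟨t, ht, hFt⟩ : ∃ t < T, F (t + 1) - F t ≤ Z / T := by
    by_contra! hcon
    have hsum : ∑ t ∈ Finset.range T, Z / T < ∑ t ∈ Finset.range T, (F (t + 1) - F t) :=
      Finset.sum_lt_sum_of_nonempty
        (Finset.nonempty_range_iff.2 (by exact_mod_cast hTpos.ne'))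
        fun t ht => hcon t (Finset.mem_range.1 ht)
    rw [Finset.sum_range_sub, Finset.sum_const, Finset.card_range, nsmul_eq_mul,
      mul_div_cancel₀ _ hTpos.ne'] at hsum
    have h3 := hFZ T
    have h4 := hrest0 T
    have h5 := hF0 0
    linarith
  obtain ⟨φ, hφ⟩ := hspec t ht
  have hround := hφ.expect_opt_ge h0 h1 hp0 hp1 hm hM hK hpos hO hOR
  have hsub : q (t + 1) ⊆ Q := by
    have hmono : ∀ s, t + 1 ≤ s → s ≤ T → q (t + 1) ⊆ q s := by
      intro s hs
      induction s, hs using Nat.le_induction with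
      | base => exact fun _ => subset_rfl
      | succ s _ ih =>
        intro hsT
        obtain ⟨ψ, hψ⟩ := hspec s hsT
        exact (ih (by omega)).trans hψ.subset
    exact hqT ▸ hmono T ht le_rfl
  refine le_trans ?_ (hround.trans (expect_mono hp0.le hp1 fun R =>
    I.opt_mono (Finset.inter_subset_inter_right hsub)))
  have h7 : 1 - 2 * ε ^ 2 ≤ (1 - ε ^ 2) / (1 + ε ^ 2) := by
    rw [le_div_iff₀ (by positivity)]
    nlinarith [sq_nonneg (ε ^ 2)]
  -- From `ε T ≥ 1 - ε > 5 / 6`.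
  have h8 : Z / T ≤ 6 / 5 * ε * Z := by
    rw [div_le_iff₀ hTpos]
    have h9 : 1 ≤ 6 / 5 * ε * T := by
      have h10 := mul_le_mul_of_nonneg_left hTge h0.le
      have h11 : ε * (1 / ε - 1) = 1 - ε := by field_simp
      linarith
    nlinarith
  have h9 := hFZ (t + 1)
  have h10 := mul_le_mul_of_nonneg_right h7 (hrest0 (t + 1))
  have h11 := hF0 (t + 1)
  have h12 := hF0 t
  change _ ≤ F t + _ - _
  -- The total loss is at most `(6/5 ε + 3 ε²) Z`, well below `6 ε Z`.
  have h13 : ε ^ 2 * Z ≤ ε * Z / 6 := by nlinarith [mul_pos h0 hpos]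
  have h14 := mul_nonneg (sq_nonneg ε) h11
  nlinarith

/-- The degree that the analysis needs is of the claimed order. -/
theorem degree_bound {ε p : ℝ} (h0 : 0 < ε) (h1 : ε < 1 / 6) (hp0 : 0 < p) (hp1 : p ≤ 1)
    {m K : ℕ} (hm : 0 < m) (hK : K = ⌈2 / ε ^ 2 * Real.log (m / ε ^ 3)⌉₊) :
    2 * ((⌈1 / ε⌉₊ - 1 : ℕ) * (K + 2) * (tau (ε ^ 2) / p + 1)) + 2 ≤
      1000 * (Real.log (1 / ε) ^ 2 * Real.log (max (m : ℝ) 2) / (ε ^ 3 * p)) := by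
  have hm' : (1 : ℝ) ≤ m := by exact_mod_cast hm
  set l := Real.log (1 / ε) with hl
  set b := Real.log (max (m : ℝ) 2) with hb
  have h2l : Real.log (1 / ε ^ 2) = 2 * l := by
    rw [hl, ← one_div_pow, Real.log_pow]
    norm_num
  have hl1 : 3 / 2 ≤ l := by
    have := PackingProblem.log_inv_sq_ge h0 h1
    linarith
  have hb1 : 2 / 3 ≤ b := by
    have h2 := Real.log_two_gt_d9
    have h3 : Real.log 2 ≤ b := Real.log_le_log (by norm_num) (le_max_right _ _)
    linarith
  have hlb : 1 ≤ l * b := by nlinarith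
  have hT : ((⌈1 / ε⌉₊ - 1 : ℕ) : ℝ) ≤ 1 / ε := by
    have h2 : (⌈1 / ε⌉₊ : ℝ) < 1 / ε + 1 := Nat.ceil_lt_add_one (by positivity)
    have h3 : 1 ≤ ⌈1 / ε⌉₊ := Nat.one_le_ceil_iff.2 (by positivity)
    rw [Nat.cast_sub h3]
    push_cast
    linarith
  have hlogm : Real.log (m / ε ^ 3) ≤ b + 3 * l := by
    have h2 : Real.log m ≤ b := Real.log_le_log (by linarith) (le_max_left _ _)
    have h3 : Real.log (1 / ε ^ 3) = 3 * l := by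
      rw [hl, ← one_div_pow, Real.log_pow]
      norm_num
    rw [div_eq_mul_one_div, Real.log_mul (by linarith) (by positivity), h3]
    linarith
  have hlogm0 : 0 ≤ Real.log (m / ε ^ 3) := by
    refine Real.log_nonneg ((one_le_div (by positivity)).2 ?_)
    exact (pow_le_one₀ h0.le (by linarith)).trans hm'
  have hKle : (K : ℝ) + 2 ≤ 14 * (l * b) / ε ^ 2 := by
    have h2 : (K : ℝ) < 2 / ε ^ 2 * Real.log (m / ε ^ 3) + 1 :=
      hK ▸ Nat.ceil_lt_add_one (by positivity)
    have h3 : (3 : ℝ) ≤ 1 / ε ^ 2 := by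
      rw [le_div_iff₀ (by positivity)]
      nlinarith
    have h4 : 2 / ε ^ 2 * Real.log (m / ε ^ 3) ≤ 2 / ε ^ 2 * (b + 3 * l) := by gcongr
    have h5 : b + 3 * l ≤ 13 / 2 * (l * b) - 1 / 2 := by nlinarith
    have h6 : 2 / ε ^ 2 * (b + 3 * l) ≤ 2 / ε ^ 2 * (13 / 2 * (l * b) - 1 / 2) := by gcongr
    have h7 : 2 / ε ^ 2 * (13 / 2 * (l * b) - 1 / 2) = 13 * (l * b) / ε ^ 2 - 1 / ε ^ 2 := by ring
    have h8 : 14 * (l * b) / ε ^ 2 = 13 * (l * b) / ε ^ 2 + l * b * (1 / ε ^ 2) := by ring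
    nlinarith
  have hτ : tau (ε ^ 2) ≤ 6 * l := by
    unfold tau
    rw [h2l]
    have h2 : Real.sqrt ((2 * l) ^ 2 + 2 * (2 * l)) ≤ 2 * l + 1 :=
      Real.sqrt_le_iff.2 ⟨by linarith, by nlinarith⟩
    linarith
  have hτ0 : 0 ≤ tau (ε ^ 2) := tau_nonneg (by positivity) (pow_le_one₀ h0.le (by linarith))
  have hτp : tau (ε ^ 2) / p + 1 ≤ 7 * l / p := by
    rw [div_add_one hp0.ne']
    gcongr
    linarith
  have hprod : (⌈1 / ε⌉₊ - 1 : ℕ) * ((K : ℝ) + 2) * (tau (ε ^ 2) / p + 1) ≤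
      1 / ε * (14 * (l * b) / ε ^ 2) * (7 * l / p) := by gcongr
  -- Doubling this and adding `2` gives at most `198` times the claimed order, so the constant
  -- `1000` is generous.
  have heq : 1 / ε * (14 * (l * b) / ε ^ 2) * (7 * l / p) = 98 * (l ^ 2 * b / (ε ^ 3 * p)) := by
    field_simp
    ring
  have hone : 1 ≤ l ^ 2 * b / (ε ^ 3 * p) := by
    rw [one_le_div (by positivity)]
    have h2 : ε ^ 3 * p ≤ 1 :=
      mul_le_one₀ (pow_le_one₀ h0.le (by linarith)) hp0.le hp1
    nlinarith
  linarith

end Guarantee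

end GAP

theorem mainTheorem4 :
    ∃ c : ℝ, 0 < c ∧
      ∀ (E : Type*) [Fintype E] [DecidableEq E] (m : ℕ) (I : GAP E m) (ε p : ℝ),
        0 < m → 0 < ε → ε < 1 / 6 → 0 < p → p ≤ 1 →
        ∀ (M : Fin m → ℝ) (K : ℕ),
          (∀ j, M j = I.toPacking.expectedOpt p / m) →
          K = ⌈2 / ε ^ 2 * Real.log (m / ε ^ 3)⌉₊ →
          (∃ Q, I.IsOutput ε p K M Q) ∧
          ∀ Q, I.IsOutput ε p K M Q →
            I.toPacking.IsSparsifying p (1 - 6 * ε)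
              (c * (Real.log (1 / ε) ^ 2 * Real.log (max (m : ℝ) 2) / (ε ^ 3 * p))) Q := by
  refine ⟨1000, by norm_num, fun E _ _ m I ε p hm h0 h1 hp0 hp1 M K hM hK =>
    ⟨I.exists_rounds ε p K M _ ∅, fun Q hQ => ⟨?_, hQ.expect_opt_ge h0 h1 hp0 hp1 hm hM hK⟩⟩⟩
  have hε2 : ε ^ 2 ≤ 1 := pow_le_one₀ h0.le (by linarith)
  have hτ : 0 ≤ GAP.tau (ε ^ 2) / p :=
    div_nonneg (GAP.tau_nonneg (by positivity) hε2) hp0.le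
  have hdeg := GAP.degree_bound h0 h1 hp0 hp1 hm hK
  have hD : 0 ≤ (⌈1 / ε⌉₊ - 1 : ℕ) * ((K : ℝ) + 2) * (GAP.tau (ε ^ 2) / p + 1) := by positivity
  obtain ⟨σ, hσ, hload⟩ := GAP.Rounds.exists_load_le hτ hm hQ
  exact ⟨by linarith, I.smul_indicatorVec_mem_polytope Q σ hσ hD hload hdeg⟩
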